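/- Let $k$ be an algebraically closed field of characteristic $p>0$. All homomorphisms below are homomorphisms of algebraic groups over $k$. Let $\mathbb{G}_a$ and $\mathbb{G}_m$ be the additive and multiplicative groups of $k$, let $\mathbb{G}_a\rtimes\mathbb{G}_m$ have the product $(t,u)(t',u')=(t+u^2t',uu')$, let $\mathrm{B}(2,k)\subset\mathrm{SL}(2,k)$ be the group of upper triangular matrices, and let $\jmath:\mathbb{G}_a\rtimes\mathbb{G}_m\to\mathrm{B}(2,k)$ be the isomorphism $\jmath(t,u)=\begin{pmatrix}1&t\\0&1\end{pmatrix}\begin{pmatrix}u&0\\0&u^{-1}\end{pmatrix}$. For maps $\varphi:\mathbb{G}_a\to\mathrm{SL}(4,k)$ and $\omega:\mathbb{G}_m\to\mathrm{SL}(4,k)$ put $\psi_{\varphi,\omega}(t,u)=\varphi(t)\,\omega(u)$. Let $\mathcal{U}_4$ be the set of homomorphisms $\varphi:\mathbb{G}_a\to\mathrm{SL}(4,k)$ all of whose values are upper triangular with diagonal entries $1$, and let $\Omega(4)$ be the set of (antisymmetric) homomorphisms $\omega:\mathbb{G}_m\to\mathrm{SL}(4,k)$ of the form $\omega(u)=\mathrm{diag}(u^{d_1},u^{d_2},u^{d_3},u^{d_4})$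 with integers $d_1\ge d_2\ge d_3\ge d_4$, $d_3=-d_2$, $d_4=-d_1$. A homomorphism $\psi:\mathrm{B}(2,k)\to\mathrm{SL}(4,k)$ is antisymmetric if $u\mapsto\psi(\mathrm{diag}(u,u^{-1}))$ lies in $\Omega(4)$. Write $(\varphi,\omega)\sim(\varphi^*,\omega^*)$ if there is $P\in\mathrm{GL}(4,k)$ with $P^{-1}\psi_{\varphi,\omega}(t,u)P=\psi_{\varphi^*,\omega^*}(t,u)$ for all $(t,u)$. A pair $(\varphi^*,\omega^*)$ has the form $(\nu)$, $\nu=\mathrm{I},\dots,\mathrm{XXVI}$, if $\omega^*(u)=\mathrm{diag}(u^{d_1},u^{d_2},u^{-d_2},u^{-d_1})$ and $\varphi^*(t)$ is the upper triangular matrix with diagonal entries $1$ whose possibly nonzero entries $a_{ij}$ ($i<j$) are those listed (all other entries above the diagonal are $0$), for some integers $e_i,f\ge 0$ and $d_1,d_2$ as listed. Here $q_i=p^{e_i}$. - (I) $p\ge5$; $d_1=3q_1$, $d_2=q_1$; $a_{12}=a_{23}=a_{34}=t^{q_1}$, $a_{13}=a_{24}=\frac12t^{2q_1}$, $a_{14}=\frac16t^{3q_1}$.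 - (II) $p=3$; $d_1=p^{e_1+1}$, $d_2=q_1$; $a_{12}=a_{23}=t^{q_1}$, $a_{13}=\frac12t^{2q_1}$, $a_{14}=t^{p^{e_1+1}}$. - (III) $p\ge3$; $d_1=3q_1$, $d_2=q_1$; $a_{12}=a_{23}=t^{q_1}$, $a_{13}=\frac12t^{2q_1}$. - (IV) $e_2>e_1$; $d_1=q_1+q_2$, $d_2=q_2-q_1$; $a_{12}=a_{34}=t^{q_1}$, $a_{13}=a_{24}=t^{q_2}$, $a_{14}=t^{q_1+q_2}$. - (V) $f\ge e_1+1$; $d_1=p^f$, $d_2=p^f-2q_1$; $a_{12}=a_{34}=t^{q_1}$, $a_{14}=t^{p^f}$. - (VI) $d_1=d_2+2q_1$, $d_2\ge0$; $a_{12}=a_{34}=t^{q_1}$. - (VII) $p=3$; $d_1=p^{e_1+1}$, $d_2=q_1$; $a_{23}=a_{34}=t^{q_1}$, $a_{24}=\frac12t^{2q_1}$, $a_{14}=t^{p^{e_1+1}}$. - (VIII) $p\ge3$; $d_1=3q_1$, $d_2=q_1$; $a_{23}=a_{34}=t^{q_1}$, $a_{24}=\frac12t^{2q_1}$. - (IX)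 $p\ge3$; $d_1=2q_1$, $d_2=0$; $a_{12}=a_{24}=t^{q_1}$, $a_{14}=\frac12t^{2q_1}$. - (X) $e_2>e_1$; $d_1=q_1+q_2$, $d_2=q_2-q_1$; $a_{12}=t^{q_1}$, $a_{13}=t^{q_2}$. - (XI) $e_3\ge e_1+1$; $d_1=q_3$, $d_2=q_3-2q_1$; $a_{12}=t^{q_1}$, $a_{14}=t^{q_3}$. - (XII) $d_1=2q_1+d_2$, $d_2\ge0$; $a_{12}=t^{q_1}$. - (XIII) $e_1>e_3$; $d_1=2q_1-q_3$, $d_2=q_3$; $a_{13}=a_{24}=t^{q_1}$, $a_{23}=t^{q_3}$. - (XIV) $e_1>e_3$; $d_1=2q_1-q_3$, $d_2=q_3$; $a_{13}=t^{q_1}$, $a_{23}=t^{q_3}$. - (XV) $e_2\ge e_3$; $d_1=q_2$, $d_2=q_3$; $a_{14}=t^{q_2}$, $a_{23}=t^{q_3}$. - (XVI) $e_4>e_3$; $d_1=2q_4-q_3$, $d_2=q_3$; $a_{23}=t^{q_3}$, $a_{24}=t^{q_4}$. - (XVII) $d_1\ge q_3$, $d_2=q_3$; $a_{23}=t^{q_3}$.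 - (XVIII) $e_2>e_1$; $d_1=q_1+q_2$, $d_2=q_2-q_1$; $a_{24}=t^{q_2}$, $a_{34}=t^{q_1}$. - (XIX) $e_3\ge e_1+1$; $d_1=q_3$, $d_2=q_3-2q_1$; $a_{14}=t^{q_3}$, $a_{34}=t^{q_1}$. - (XX) $d_1=2q_1+d_2$, $d_2\ge0$; $a_{34}=t^{q_1}$. - (XXI) $p=2$; $d_1=p^{e_1+1}$, $d_2=0$; $a_{13}=a_{24}=t^{q_1}$, $a_{14}=t^{p^{e_1+1}}$. - (XXII) $2q_1\ge d_1\ge q_1$, $d_2=2q_1-d_1$; $a_{13}=a_{24}=t^{q_1}$. - (XXIII) $2q_1\ge d_1\ge q_1$, $d_2=2q_1-d_1$; $a_{13}=t^{q_1}$. - (XXIV) $d_1=q_2$, $q_2\ge d_2\ge0$; $a_{14}=t^{q_2}$. - (XXV) $2q_3\ge d_1\ge q_3$, $d_2=2q_3-d_1$; $a_{24}=t^{q_3}$. - (XXVI) $d_1\ge d_2\ge0$; $\varphi^*(t)=I_4$. **Theorem.** (1) If $(\varphi^*,\omega^*)$ has one of the forms (I)–(XXVI), then $\varphi^*$, $\omega^*$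 and $\psi_{\varphi^*,\omega^*}:\mathbb{G}_a\rtimes\mathbb{G}_m\to\mathrm{SL}(4,k)$ are homomorphisms and $\omega^*\in\Omega(4)$. (2) Let $\psi:\mathrm{B}(2,k)\to\mathrm{SL}(4,k)$ be an antisymmetric homomorphism. Then $\psi\circ\jmath=\psi_{\varphi,\omega}$ for some $(\varphi,\omega)\in\mathcal{U}_4\times\Omega(4)$, and for every such $(\varphi,\omega)$ there exists $(\varphi^*,\omega^*)\in\mathcal{U}_4\times\Omega(4)$ such that $(\varphi,\omega)\sim(\varphi^*,\omega^*)$ and $(\varphi^*,\omega^*)$ has one of the forms (I)–(XXVI). -/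

import Mathlib

namespace BorelRep

/-- Coordinates on the set `X` of `k`-points of an affine variety: a chosen (finite) system of
generators of its coordinate ring, i.e. a closed embedding of `X` in an affine space. Only the
instances given below are used. -/
class AffineCoords (k : Type*) (X : Type*) where
  Index : Type
  coord : X → Index → k

/-- A map between (the sets of `k`-points of) affine varieties is a morphism if each coordinate
of the image is a polynomial in the coordinates of the argument. -/
def IsMorphism (k : Type*) [Field k] {X Y : Type*} [AffineCoords k X] [AffineCoords k Y]
    (f : X → Y) : Prop :=
  ∀ j : AffineCoords.Index k Y, ∃ P : MvPolynomial (AffineCoords.Index k X) k,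
    ∀ x : X, AffineCoords.coord (f x) j = MvPolynomial.eval (AffineCoords.coord x) P

/-- A homomorphism of algebraic groups: a morphism of varieties that is multiplicative. -/
structure IsAlgHom (k : Type*) [Field k] {G H : Type*} [Group G] [Group H]
    [AffineCoords k G] [AffineCoords k H] (f : G → H) : Prop where
  map_mul : ∀ x y : G, f (x * y) = f x * f y
  isMorphism : IsMorphism k f

section Groups

variable (k : Type*) [Field k]

/-- The additive group of `k` (written multiplicatively). -/
abbrev Ga := Multiplicative k

/-- The multiplicative group of `k`. -/
abbrev Gm := kˣ

/-- The special linear group `SL(n, k)`. -/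
abbrev SLn (n : ℕ) := Matrix.SpecialLinearGroup (Fin n) k

/-- `u ∈ 𝔾ₘ` acts on `𝔾ₐ` by `t ↦ u ^ 2 * t`. -/
def squareAction : Gm k →* MulAut (Ga k) where
  toFun u := AddEquiv.toMultiplicative (DistribMulAction.toAddEquiv k (u ^ 2))
  map_one' := by ext t; simp
  map_mul' u v := by ext t; simp [mul_pow, mul_smul]

/-- The semidirect product `𝔾ₐ ⋊ 𝔾ₘ`. -/
abbrev GaGm := Ga k ⋊[squareAction k] Gm k

/-- The multiplication is `(t, u) (t', u') = (t + u ^ 2 * t', u * u')`. -/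
theorem GaGm.mul_def (x y : GaGm k) :
    x * y = ⟨.ofAdd (x.left.toAdd + (x.right : k) ^ 2 * y.left.toAdd), x.right * y.right⟩ :=
  rfl

/-- The Borel subgroup `B(2, k)` of upper triangular matrices of `SL(2, k)`. -/
def Borel : Subgroup (SLn k 2) where
  carrier := {A | A 1 0 = 0}
  one_mem' := by simp
  mul_mem' := by
    intro A B hA hB
    simp only [Set.mem_ofPred_eq] at *
    simp [Matrix.mul_apply, Fin.sum_univ_two, hA, hB]
  inv_mem' := by
    intro A hA
    simp only [Set.mem_ofPred_eq] at *
    simp [Matrix.SpecialLinearGroup.coe_inv, Matrix.adjugate_fin_two, hA]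

instance : AffineCoords k (Ga k) where
  Index := Fin 1
  coord t := ![t.toAdd]

instance : AffineCoords k (Gm k) where
  Index := Fin 2
  coord u := ![(u : k), ((u⁻¹ : kˣ) : k)]

instance : AffineCoords k (GaGm k) where
  Index := Fin 3
  coord x := ![x.left.toAdd, (x.right : k), ((x.right⁻¹ : kˣ) : k)]

instance (n : ℕ) : AffineCoords k (SLn k n) where
  Index := Fin n × Fin n
  coord A ij := A.1 ij.1 ij.2

instance : AffineCoords k (Borel k) where
  Index := Fin 2 × Fin 2
  coord b ij := b.1.1 ij.1 ij.2

end Groups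

section Pairs

variable {k : Type*} [Field k] {n : ℕ}

/-- The isomorphism `𝔾ₐ ⋊ 𝔾ₘ → B(2, k)`. -/
def jmath (x : GaGm k) : Borel k :=
  ⟨⟨!![(x.right : k), x.left.toAdd * ((x.right⁻¹ : kˣ) : k); 0, ((x.right⁻¹ : kˣ) : k)],
    by simp [Matrix.det_fin_two]⟩, rfl⟩

/-- The morphism `ψ_{φ, ω}(t, u) = φ(t) ω(u)`. -/
def psiOf (φ : Ga k → SLn k n) (ω : Gm k → SLn k n) (x : GaGm k) : SLn k n :=
  φ x.left * ω x.right

/-- `Inn_P(A) = P⁻¹ A P` for `P ∈ GL(n, k)`, `A ∈ SL(n, k)`. -/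
def Inn (P : GL (Fin n) k) (A : SLn k n) : SLn k n :=
  ⟨(P⁻¹ : GL (Fin n) k).1 * A.1 * P.1, by
    rw [Matrix.det_units_conj']; exact A.2⟩

/-- Equivalence `(φ, ω) ∼ (φ*, ω*)` of pairs. -/
def PairEquiv (φ : Ga k → SLn k n) (ω : Gm k → SLn k n)
    (φ' : Ga k → SLn k n) (ω' : Gm k → SLn k n) : Prop :=
  ∃ P : GL (Fin n) k, Inn P ∘ psiOf φ ω = psiOf φ' ω'

/-- The set `Ω(n)` of antisymmetric homomorphisms `𝔾ₘ → SL(n, k)`: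
`ω(u) = diag(u ^ d₁, …, u ^ dₙ)` with `d₁ ≥ ⋯ ≥ dₙ` and `dᵢ = - d_{n-i+1}`. -/
def Omega (k : Type*) [Field k] (n : ℕ) : Set (Gm k → SLn k n) :=
  {ω | ∃ d : Fin n → ℤ, Antitone d ∧ (∀ i, d i = - d i.rev) ∧
    ∀ u : Gm k, (ω u).1 = Matrix.diagonal fun i => ((u ^ d i : kˣ) : k)}

/-- The set `𝒰ₙ` of homomorphisms `𝔾ₐ → SL(n, k)` whose values are upper triangular
with diagonal entries `1`. -/
def UnipotentUpper (k : Type*) [Field k] (n : ℕ) : Set (Ga k → SLn k n) :=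
  {φ | IsAlgHom k φ ∧ ∀ t, (∀ i j, j < i → (φ t).1 i j = 0) ∧ ∀ i, (φ t).1 i i = 1}

/-- A homomorphism `ψ : B(2, k) → SL(n, k)` of algebraic groups is antisymmetric if
`u ↦ ψ (diag(u, u⁻¹))` lies in `Ω(n)`. -/
def IsAntisymmetricHom (ψ : Borel k → SLn k n) : Prop :=
  IsAlgHom k ψ ∧ (fun u : Gm k => ψ (jmath ⟨.ofAdd 0, u⟩)) ∈ Omega k n

/-- The upper unitriangular `4 × 4` matrix with the given entries above the diagonal. -/
def uni (a₁₂ a₁₃ a₁₄ a₂₃ a₂₄ a₃₄ : k) : SLn k 4 :=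
  ⟨!![1, a₁₂, a₁₃, a₁₄;
      0, 1, a₂₃, a₂₄;
      0, 0, 1, a₃₄;
      0, 0, 0, 1], by
    simp [Matrix.det_succ_row_zero, Fin.sum_univ_succ, Fin.succAbove]⟩

/-- `ω*(u) = diag(u ^ d₁, u ^ d₂, u ^ (-d₂), u ^ (-d₁))`. -/
def omegaStar (d₁ d₂ : ℤ) (u : Gm k) : SLn k 4 :=
  ⟨Matrix.diagonal ![((u ^ d₁ : kˣ) : k), ((u ^ d₂ : kˣ) : k),
      ((u ^ (-d₂) : kˣ) : k), ((u ^ (-d₁) : kˣ) : k)], by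
    rw [Matrix.det_diagonal, Fin.prod_univ_four]
    simp only [Matrix.cons_val]
    rw [← Units.val_mul, ← Units.val_mul, ← Units.val_mul, ← zpow_add, ← zpow_add, ← zpow_add]
    simp⟩

/-- The labels of the 26 forms. -/
inductive Label
  | I | II | III | IV | V | VI | VII | VIII | IX | X | XI | XII | XIII
  | XIV | XV | XVI | XVII | XVIII | XIX | XX | XXI | XXII | XXIII | XXIV | XXV | XXVI

/-- `φ(t) = A(t)` for all `t`, and `ω(u) = diag(u ^ d₁, u ^ d₂, u ^ (-d₂), u ^ (-d₁))`. -/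
def IsPair (φ : Ga k → SLn k 4) (ω : Gm k → SLn k 4) (d₁ d₂ : ℤ) (A : k → SLn k 4) : Prop :=
  (∀ t : Ga k, φ t = A t.toAdd) ∧ ω = omegaStar d₁ d₂

/-- The pair `(φ, ω)` has the form `(ν)`, where `p` is the characteristic of `k`. -/
def HasForm (p : ℕ) (φ : Ga k → SLn k 4) (ω : Gm k → SLn k 4) : Label → Prop
  | .I => 5 ≤ p ∧ ∃ e₁ : ℕ,
      IsPair φ ω (3 * (p : ℤ) ^ e₁) ((p : ℤ) ^ e₁) fun t =>
        uni (t ^ p ^ e₁) (1 / 2 * t ^ (2 * p ^ e₁)) (1 / 6 * t ^ (3 * p ^ e₁))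
                              (t ^ p ^ e₁)          (1 / 2 * t ^ (2 * p ^ e₁))
                                                            (t ^ p ^ e₁)
  | .II => p = 3 ∧ ∃ e₁ : ℕ,
      IsPair φ ω ((p : ℤ) ^ (e₁ + 1)) ((p : ℤ) ^ e₁) fun t =>
        uni (t ^ p ^ e₁) (1 / 2 * t ^ (2 * p ^ e₁)) (t ^ p ^ (e₁ + 1))
                              (t ^ p ^ e₁)                  0
                                                            0
  | .III => 3 ≤ p ∧ ∃ e₁ : ℕ,
      IsPair φ ω (3 * (p : ℤ) ^ e₁) ((p : ℤ) ^ e₁) fun t =>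
        uni (t ^ p ^ e₁) (1 / 2 * t ^ (2 * p ^ e₁)) 0
                              (t ^ p ^ e₁)          0
                                                    0
  | .IV => ∃ e₁ e₂ : ℕ, e₁ < e₂ ∧
      IsPair φ ω ((p : ℤ) ^ e₁ + (p : ℤ) ^ e₂) ((p : ℤ) ^ e₂ - (p : ℤ) ^ e₁) fun t =>
        uni (t ^ p ^ e₁) (t ^ p ^ e₂) (t ^ (p ^ e₁ + p ^ e₂))
                              0       (t ^ p ^ e₂)
                                      (t ^ p ^ e₁)
  | .V => ∃ e₁ f : ℕ, e₁ + 1 ≤ f ∧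
      IsPair φ ω ((p : ℤ) ^ f) ((p : ℤ) ^ f - 2 * (p : ℤ) ^ e₁) fun t =>
        uni (t ^ p ^ e₁) 0 (t ^ p ^ f)
                         0      0
                           (t ^ p ^ e₁)
  | .VI => ∃ (e₁ : ℕ) (d₂ : ℤ), 0 ≤ d₂ ∧
      IsPair φ ω (d₂ + 2 * (p : ℤ) ^ e₁) d₂ fun t =>
        uni (t ^ p ^ e₁) 0 0
                         0 0
                           (t ^ p ^ e₁)
  | .VII => p = 3 ∧ ∃ e₁ : ℕ,
      IsPair φ ω ((p : ℤ) ^ (e₁ + 1)) ((p : ℤ) ^ e₁) fun t =>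
        uni 0       0       (t ^ p ^ (e₁ + 1))
              (t ^ p ^ e₁)  (1 / 2 * t ^ (2 * p ^ e₁))
                            (t ^ p ^ e₁)
  | .VIII => 3 ≤ p ∧ ∃ e₁ : ℕ,
      IsPair φ ω (3 * (p : ℤ) ^ e₁) ((p : ℤ) ^ e₁) fun t =>
        uni 0       0                  0
              (t ^ p ^ e₁)  (1 / 2 * t ^ (2 * p ^ e₁))
                            (t ^ p ^ e₁)
  | .IX => 3 ≤ p ∧ ∃ e₁ : ℕ,
      IsPair φ ω (2 * (p : ℤ) ^ e₁) 0 fun t =>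
        uni (t ^ p ^ e₁) 0 (1 / 2 * t ^ (2 * p ^ e₁))
                         0 (t ^ p ^ e₁)
                           0
  | .X => ∃ e₁ e₂ : ℕ, e₁ < e₂ ∧
      IsPair φ ω ((p : ℤ) ^ e₁ + (p : ℤ) ^ e₂) ((p : ℤ) ^ e₂ - (p : ℤ) ^ e₁) fun t =>
        uni (t ^ p ^ e₁) (t ^ p ^ e₂) 0
                              0       0
                                      0
  | .XI => ∃ e₁ e₃ : ℕ, e₁ + 1 ≤ e₃ ∧
      IsPair φ ω ((p : ℤ) ^ e₃) ((p : ℤ) ^ e₃ - 2 * (p : ℤ) ^ e₁) fun t =>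
        uni (t ^ p ^ e₁) 0 (t ^ p ^ e₃)
                         0 0
                           0
  | .XII => ∃ (e₁ : ℕ) (d₂ : ℤ), 0 ≤ d₂ ∧
      IsPair φ ω (2 * (p : ℤ) ^ e₁ + d₂) d₂ fun t =>
        uni (t ^ p ^ e₁) 0 0
                         0 0
                           0
  | .XIII => ∃ e₁ e₃ : ℕ, e₃ < e₁ ∧
      IsPair φ ω (2 * (p : ℤ) ^ e₁ - (p : ℤ) ^ e₃) ((p : ℤ) ^ e₃) fun t =>
        uni 0 (t ^ p ^ e₁) 0
              (t ^ p ^ e₃) (t ^ p ^ e₁)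
                           0
  | .XIV => ∃ e₁ e₃ : ℕ, e₃ < e₁ ∧
      IsPair φ ω (2 * (p : ℤ) ^ e₁ - (p : ℤ) ^ e₃) ((p : ℤ) ^ e₃) fun t =>
        uni 0 (t ^ p ^ e₁) 0
              (t ^ p ^ e₃) 0
                           0
  | .XV => ∃ e₂ e₃ : ℕ, e₃ ≤ e₂ ∧
      IsPair φ ω ((p : ℤ) ^ e₂) ((p : ℤ) ^ e₃) fun t =>
        uni 0       0      (t ^ p ^ e₂)
              (t ^ p ^ e₃) 0
                           0
  | .XVI => ∃ e₃ e₄ : ℕ, e₃ < e₄ ∧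
      IsPair φ ω (2 * (p : ℤ) ^ e₄ - (p : ℤ) ^ e₃) ((p : ℤ) ^ e₃) fun t =>
        uni 0       0      0
              (t ^ p ^ e₃) (t ^ p ^ e₄)
                           0
  | .XVII => ∃ (e₃ : ℕ) (d₁ : ℤ), (p : ℤ) ^ e₃ ≤ d₁ ∧
      IsPair φ ω d₁ ((p : ℤ) ^ e₃) fun t =>
        uni 0       0      0
              (t ^ p ^ e₃) 0
                           0
  | .XVIII => ∃ e₁ e₂ : ℕ, e₁ < e₂ ∧
      IsPair φ ω ((p : ℤ) ^ e₁ + (p : ℤ) ^ e₂) ((p : ℤ) ^ e₂ - (p : ℤ) ^ e₁) fun t =>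
        uni 0 0 0
              0 (t ^ p ^ e₂)
                (t ^ p ^ e₁)
  | .XIX => ∃ e₁ e₃ : ℕ, e₁ + 1 ≤ e₃ ∧
      IsPair φ ω ((p : ℤ) ^ e₃) ((p : ℤ) ^ e₃ - 2 * (p : ℤ) ^ e₁) fun t =>
        uni 0 0 (t ^ p ^ e₃)
              0 0
                (t ^ p ^ e₁)
  | .XX => ∃ (e₁ : ℕ) (d₂ : ℤ), 0 ≤ d₂ ∧
      IsPair φ ω (2 * (p : ℤ) ^ e₁ + d₂) d₂ fun t =>
        uni 0 0 0
              0 0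
                (t ^ p ^ e₁)
  | .XXI => p = 2 ∧ ∃ e₁ : ℕ,
      IsPair φ ω ((p : ℤ) ^ (e₁ + 1)) 0 fun t =>
        uni 0 (t ^ p ^ e₁) (t ^ p ^ (e₁ + 1))
                   0       (t ^ p ^ e₁)
                           0
  | .XXII => ∃ (e₁ : ℕ) (d₁ : ℤ), (p : ℤ) ^ e₁ ≤ d₁ ∧ d₁ ≤ 2 * (p : ℤ) ^ e₁ ∧
      IsPair φ ω d₁ (2 * (p : ℤ) ^ e₁ - d₁) fun t =>
        uni 0 (t ^ p ^ e₁) 0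
                   0       (t ^ p ^ e₁)
                           0
  | .XXIII => ∃ (e₁ : ℕ) (d₁ : ℤ), (p : ℤ) ^ e₁ ≤ d₁ ∧ d₁ ≤ 2 * (p : ℤ) ^ e₁ ∧
      IsPair φ ω d₁ (2 * (p : ℤ) ^ e₁ - d₁) fun t =>
        uni 0 (t ^ p ^ e₁) 0
                   0       0
                           0
  | .XXIV => ∃ (e₂ : ℕ) (d₂ : ℤ), 0 ≤ d₂ ∧ d₂ ≤ (p : ℤ) ^ e₂ ∧
      IsPair φ ω ((p : ℤ) ^ e₂) d₂ fun t =>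
        uni 0 0 (t ^ p ^ e₂)
              0 0
                0
  | .XXV => ∃ (e₃ : ℕ) (d₁ : ℤ), (p : ℤ) ^ e₃ ≤ d₁ ∧ d₁ ≤ 2 * (p : ℤ) ^ e₃ ∧
      IsPair φ ω d₁ (2 * (p : ℤ) ^ e₃ - d₁) fun t =>
        uni 0 0 0
              0 (t ^ p ^ e₃)
                0
  | .XXVI => ∃ d₁ d₂ : ℤ, 0 ≤ d₂ ∧ d₂ ≤ d₁ ∧
      IsPair φ ω d₁ d₂ fun _ => 1

end Pairs

end BorelRep

open BorelRep

/-! Restricting ψ∘j to the two factors gives φ and ω, with ω(u) = diag(u^{d_i}). The relation (u²t,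
1)(0, u) = (0, u)(t, 1) makes each entry of φ a polynomial P with P(u²t) = u^{d_i - d_j} P(t). Since
k is infinite, P is zero or a monomial of degree (d_i - d_j)/2 (`homog_of_eval_sq_mul`,
`homog_entry`). On and below the diagonal this forces constants, so φ is unitriangular; above it,
only d₁, d₂ and six constants remain. If d₁ - d₂ is odd, only a₁₄ and a₂₃ survive. Otherwise put d₁
- d₂ = 2m and d₂ = n: the exponents are m for a₁₂ and a₃₄, n for a₂₃, m + n for a₁₃ and a₂₄, 2m + n
for a₁₄.

Multiplicativity of φ is then a system of identities between monomials in s and t (`UniAdditive`).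
Three remarks cut down the possible supports. A nonzero additive monomial has exponent a power of p
(`eq_zero_or_eq_pow_of_additive`). No power of p lies strictly between p^a and 2p^a
(`two_mul_le_of_prime_pow_lt`). Finally, (s + t)^N is symmetric in s and t, so the cross terms of a
non-additive entry must be symmetric too, which ties together the constants, or m and n.

The surviving constants are normalised by matrices commuting with ω. Diagonal ones suffice when 0 <
d₂ < d₁. When d₂ = 0 a middle GL₂ acts on a row (a₁₂, a₁₃) and a column (a₂₄, a₃₄), whose pairing is
the invariant; when d₁ = d₂ two copies of GL₂ act on a 2×2 block, whose rank is the invariant. -/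

namespace BorelRep

/-! ### Morphisms of affine varieties -/

section Morphisms

variable {k : Type*} [Field k]

theorem IsMorphism.comp {X Y Z : Type*} [AffineCoords k X] [AffineCoords k Y] [AffineCoords k Z]
    {g : Y → Z} {f : X → Y} (hg : IsMorphism k g) (hf : IsMorphism k f) :
    IsMorphism k (g ∘ f) := by
  intro j
  obtain ⟨Q, hQ⟩ := hg j
  choose P hP using hf
  refine ⟨MvPolynomial.bind₁ P Q, fun x => ?_⟩
  have h : (AffineCoords.coord (f x) : AffineCoords.Index k Y → k) =
      fun i => MvPolynomial.eval (AffineCoords.coord x) (P i) := funext fun i => hP i x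
  rw [Function.comp_apply, hQ, h, ← MvPolynomial.coe_aeval_eq_eval,
    ← MvPolynomial.coe_aeval_eq_eval]
  simp only [RingHom.coe_coe, MvPolynomial.aeval_bind₁]

theorem isMorphism_SLn_iff {X : Type*} [AffineCoords k X] {n : ℕ} {f : X → SLn k n} :
    IsMorphism k f ↔ ∀ i j, ∃ P : MvPolynomial (AffineCoords.Index k X) k,
      ∀ x, (f x).1 i j = MvPolynomial.eval (AffineCoords.coord x) P :=
  ⟨fun h i j => h (i, j), fun h ij => h ij.1 ij.2⟩

theorem IsMorphism.mul {X : Type*} [AffineCoords k X] {n : ℕ} {f g : X → SLn k n}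
    (hf : IsMorphism k f) (hg : IsMorphism k g) : IsMorphism k (fun x => f x * g x) := by
  rw [isMorphism_SLn_iff] at *
  choose P hP using hf
  choose Q hQ using hg
  refine fun i j => ⟨∑ l, P i l * Q l j, fun x => ?_⟩
  simp only [map_sum, map_mul, ← hP, ← hQ]
  rw [Matrix.SpecialLinearGroup.coe_mul, Matrix.mul_apply]

theorem isMorphism_left : IsMorphism k (fun x : GaGm k => x.left) :=
  fun _ => ⟨MvPolynomial.X (0 : Fin 3), fun x => by
    simp [AffineCoords.coord]⟩

theorem isMorphism_right : IsMorphism k (fun x : GaGm k => x.right) := by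
  intro j
  change Fin 2 at j
  fin_cases j
  · exact ⟨MvPolynomial.X (1 : Fin 3), fun x => by simp [AffineCoords.coord]⟩
  · exact ⟨MvPolynomial.X (2 : Fin 3), fun x => by simp [AffineCoords.coord]⟩

theorem isMorphism_jmath_left : IsMorphism k (fun t : Ga k => jmath (⟨t, 1⟩ : GaGm k)) := by
  rintro ⟨i, j⟩
  change ∃ P : MvPolynomial (Fin 1) k, _
  fin_cases i <;> fin_cases j
  · exact ⟨1, fun x => by simp [AffineCoords.coord, jmath]⟩
  · exact ⟨MvPolynomial.X 0, fun x => by simp [AffineCoords.coord, jmath]⟩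
  · exact ⟨0, fun x => by simp [AffineCoords.coord, jmath]⟩
  · exact ⟨1, fun x => by simp [AffineCoords.coord, jmath]⟩

theorem jmath_mul (x y : GaGm k) : jmath (x * y) = jmath x * jmath y := by
  apply Subtype.ext
  apply Subtype.ext
  change (jmath (x * y)).1.1 = (jmath x).1.1 * (jmath y).1.1
  rw [GaGm.mul_def]
  have hx : (x.right : k) ≠ 0 := x.right.ne_zero
  have hy : (y.right : k) ≠ 0 := y.right.ne_zero
  ext i j
  fin_cases i <;> fin_cases j
  · simp [jmath, Matrix.mul_apply, Fin.sum_univ_two]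
  · simp [jmath, Matrix.mul_apply, Fin.sum_univ_two]
    field_simp
    ring
  · simp [jmath, Matrix.mul_apply, Fin.sum_univ_two]
  · simp [jmath, Matrix.mul_apply, Fin.sum_univ_two, mul_comm]

theorem exists_eval_eq_zpow (d : ℤ) : ∃ P : MvPolynomial (Fin 2) k, ∀ u : Gm k,
    ((u ^ d : kˣ) : k) = MvPolynomial.eval (AffineCoords.coord u) P := by
  obtain ⟨n, rfl | rfl⟩ := d.eq_nat_or_neg
  · exact ⟨MvPolynomial.X 0 ^ n, fun u => by simp [AffineCoords.coord]⟩
  · exact ⟨MvPolynomial.X 1 ^ n, fun u => by simp [AffineCoords.coord]⟩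

/-- A polynomial function in the coordinate of `𝔾ₐ` is given by a one-variable polynomial. -/
theorem exists_polynomial_of_isMorphism {n : ℕ} {φ : Ga k → SLn k n} (h : IsMorphism k φ)
    (i j : Fin n) : ∃ P : Polynomial k, ∀ t : k, (φ (.ofAdd t)).1 i j = P.eval t := by
  obtain ⟨Q, hQ⟩ := isMorphism_SLn_iff.1 h i j
  change MvPolynomial (Fin 1) k at Q
  refine ⟨MvPolynomial.aeval (fun _ => Polynomial.X) Q, fun t => ?_⟩
  rw [hQ]
  have e : (Polynomial.aeval t).comp
      (MvPolynomial.aeval fun _ : Fin 1 => (Polynomial.X : Polynomial k)) =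
      MvPolynomial.aeval fun _ => t := MvPolynomial.algHom_ext (by simp)
  have e' := DFunLike.congr_fun e Q
  rw [AlgHom.comp_apply, Polynomial.coe_aeval_eq_eval, MvPolynomial.aeval_eq_eval] at e'
  refine Eq.trans ?_ e'.symm
  have : @AffineCoords.coord k (Ga k) _ (.ofAdd t) = fun _ : Fin 1 => t := by
    funext (i : Fin 1)
    fin_cases i
    simp [AffineCoords.coord]
  rw [← this]

end Morphisms

/-! ### Weights, monomials and additive powers -/

section Monomials

variable {k : Type*} [Field k]

/-- `f` is a monomial function of weight `w` for the action `t ↦ u ^ 2 * t`. -/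
def Homog (w : ℤ) (f : k → k) : Prop :=
  ∃ (c : k) (m : ℕ), (∀ t, f t = c * t ^ m) ∧ (c = 0 ∨ 2 * (m : ℤ) = w)

theorem homog_zero (w : ℤ) : Homog w (fun _ : k => 0) :=
  ⟨0, 0, by simp, .inl rfl⟩

theorem homog_pow {w : ℤ} {m : ℕ} (h : 2 * (m : ℤ) = w) : Homog w (fun t : k => t ^ m) :=
  ⟨1, m, by simp, .inr h⟩

theorem homog_mul_pow {w : ℤ} {m : ℕ} (c : k) (h : 2 * (m : ℤ) = w) :
    Homog w (fun t : k => c * t ^ m) :=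
  ⟨c, m, by simp, .inr h⟩

theorem Homog.apply_sq_mul {w : ℤ} {f : k → k} (h : Homog w f) (u : kˣ) (t : k) :
    f ((u : k) ^ 2 * t) = ((u ^ w : kˣ) : k) * f t := by
  obtain ⟨c, m, hf, rfl | rfl⟩ := h
  · simp [hf]
  · rw [hf, hf, zpow_mul, zpow_natCast, zpow_ofNat]
    push_cast
    ring

theorem eq_zero_of_forall_zpow_eq_one [Infinite k] {w : ℤ}
    (h : ∀ u : kˣ, u ^ w = 1) : w = 0 := by
  by_contra hw
  have hpos : 0 < w.natAbs := Int.natAbs_pos.2 hw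
  have h1 : ∀ u : kˣ, u ^ w.natAbs = 1 := fun u => by
    rw [← zpow_natCast]
    rcases Int.natAbs_eq w with e | e
    · rw [← e, h]
    · have := h u
      rw [e, zpow_neg, inv_eq_one] at this
      exact this
  -- The extra factor X makes the polynomial vanish at 0 as well, hence on all of the infinite
  -- field.
  have h2 : (Polynomial.X ^ (w.natAbs + 1) - Polynomial.X : Polynomial k) = 0 := by
    refine Polynomial.funext fun r => ?_
    rcases eq_or_ne r 0 with rfl | hr
    · simp
    · have := congrArg Units.val (h1 (Units.mk0 r hr))
      simp at this
      simp [pow_succ, this]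
  have h3 := congrArg (fun P => Polynomial.coeff P 1) h2
  simp [Polynomial.coeff_X_pow] at h3
  rw [if_neg (by omega)] at h3
  simp at h3

/-- Comparing coefficients in degree m gives u^{2m} = u^w for all u whenever that coefficient is
nonzero, so 2m = w: at most one degree occurs. -/
theorem homog_of_eval_sq_mul [Infinite k] {w : ℤ} {P : Polynomial k}
    (h : ∀ (u : kˣ) (t : k), P.eval ((u : k) ^ 2 * t) = ((u ^ w : kˣ) : k) * P.eval t) :
    Homog w (fun t => P.eval t) := by
  have key : ∀ m, P.coeff m ≠ 0 → 2 * (m : ℤ) = w := by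
    intro m hm
    have : 2 * (m : ℤ) - w = 0 := by
      refine eq_zero_of_forall_zpow_eq_one (k := k) fun u => ?_
      have e : P.comp (Polynomial.C ((u : k) ^ 2) * Polynomial.X) =
          Polynomial.C ((u ^ w : kˣ) : k) * P := by
        refine Polynomial.funext fun t => ?_
        simpa using h u t
      have e1 := congrArg (fun Q => Polynomial.coeff Q m) e
      simp only [Polynomial.comp_C_mul_X_coeff, Polynomial.coeff_C_mul] at e1
      rw [mul_comm] at e1
      have e2 := mul_right_cancel₀ hm e1
      have e3 : u ^ (2 * (m : ℤ)) = u ^ w := by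
        ext
        rw [← e2, zpow_mul, zpow_natCast, zpow_ofNat]
        push_cast
        ring
      rw [zpow_sub, e3, mul_inv_cancel]
    omega
  rcases eq_or_ne P 0 with rfl | hP
  · simpa using homog_zero (k := k) w
  · refine ⟨P.leadingCoeff, P.natDegree, fun t => ?_,
      .inr (key _ (by simpa using hP))⟩
    have hd := key P.natDegree (by simpa using hP)
    have : P = Polynomial.C P.leadingCoeff * Polynomial.X ^ P.natDegree := by
      ext m
      rw [Polynomial.coeff_C_mul, Polynomial.coeff_X_pow]
      split_ifs with hm
      · rw [hm, mul_one]; rfl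
      · rw [mul_zero]
        by_contra hne
        have := key m hne
        omega
    conv_lhs => rw [this]
    simp

/-- Linear independence of two distinct power functions on an infinite field. -/
theorem eq_zero_of_forall_add_pow_eq_zero [Infinite k] {a b : ℕ} (hab : a ≠ b) {A B : k}
    (h : ∀ x : k, A * x ^ a + B * x ^ b = 0) : A = 0 ∧ B = 0 := by
  have e : Polynomial.C A * Polynomial.X ^ a + Polynomial.C B * Polynomial.X ^ b = 0 :=
    Polynomial.funext fun x => by simpa using h x
  have ea := congrArg (fun P => Polynomial.coeff P a) e
  have eb := congrArg (fun P => Polynomial.coeff P b) e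
  simp [Polynomial.coeff_X_pow, hab, hab.symm] at ea eb
  exact ⟨ea, eb⟩

/-- Write m = p^e r with p not dividing r. Frobenius absorbs p^e and leaves (X + 1)^r = X^r + 1,
whose linear coefficient is r on the left; if r ≠ 1 it is 0 on the right, so p would divide r. -/
theorem eq_zero_or_eq_pow_of_additive [IsAlgClosed k] (p : ℕ) [Fact p.Prime] [CharP k p]
    {c : k} {m : ℕ} (h : ∀ s t : k, c * (s + t) ^ m = c * s ^ m + c * t ^ m) :
    c = 0 ∨ ∃ e : ℕ, m = p ^ e := by
  have hp : p.Prime := Fact.out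
  rw [or_iff_not_imp_left]
  intro hc
  have h' : ∀ s t : k, (s + t) ^ m = s ^ m + t ^ m := fun s t =>
    mul_left_cancel₀ hc (by rw [h, mul_add])
  have hm : m ≠ 0 := by
    rintro rfl
    simpa using h' 0 0
  obtain ⟨e, r, hr, rfl⟩ := Nat.exists_eq_pow_mul_and_not_dvd hm p hp.ne_one
  refine ⟨e, ?_⟩
  suffices r = 1 by rw [this, mul_one]
  by_contra hr1
  have hr0 : r ≠ 0 := by rintro rfl; simp at hr
  have key : ((Polynomial.X + 1) ^ r : Polynomial k) = Polynomial.X ^ r + 1 := by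
    refine Polynomial.funext fun x => ?_
    -- Every x is a p^e-th power, so the identity in y yields one in x.
    obtain ⟨y, rfl⟩ := IsAlgClosed.exists_pow_nat_eq x (pow_pos hp.pos e)
    have := h' y 1
    rw [pow_mul, add_pow_char_pow, one_pow, one_pow, pow_mul] at this
    simpa using this
  have := congrArg (fun P => Polynomial.coeff P 1) key
  simp [Polynomial.coeff_X_add_one_pow, Polynomial.coeff_X_pow, Ne.symm hr1,
    Polynomial.coeff_one] at this
  exact hr ((CharP.cast_eq_zero_iff k p r).1 this)

end Monomials



/-! ### Unitriangular matrices and torus conjugation -/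

section Uni

variable {k : Type*} [Field k]

theorem uni_mul (a b c d e f a' b' c' d' e' f' : k) :
    uni a b c d e f * uni a' b' c' d' e' f' =
      uni (a' + a) (b' + a * d' + b) (c' + a * e' + b * f' + c) (d' + d) (e' + d * f' + e)
        (f' + f) := by
  apply Subtype.ext
  rw [Matrix.SpecialLinearGroup.coe_mul]
  ext i j
  fin_cases i <;> fin_cases j <;> simp [uni, Matrix.mul_apply, Fin.sum_univ_four]

theorem uni_zero : uni (0 : k) 0 0 0 0 0 = 1 := by
  apply Subtype.ext
  ext i j
  fin_cases i <;> fin_cases j <;> simp [uni]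

theorem uni_inj {a b c d e f a' b' c' d' e' f' : k} :
    uni a b c d e f = uni a' b' c' d' e' f' ↔
      a = a' ∧ b = b' ∧ c = c' ∧ d = d' ∧ e = e' ∧ f = f' := by
  refine ⟨fun h => ?_, by rintro ⟨rfl, rfl, rfl, rfl, rfl, rfl⟩; rfl⟩
  have h' := fun i j => congrFun (congrFun (congrArg Subtype.val h) i) j
  exact ⟨by simpa [uni] using h' 0 1, by simpa [uni] using h' 0 2, by simpa [uni] using h' 0 3,
    by simpa [uni] using h' 1 2, by simpa [uni] using h' 1 3, by simpa [uni] using h' 2 3⟩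

theorem eq_uni {A : SLn k 4} (h : ∀ i j, j < i → A.1 i j = 0) (h1 : ∀ i, A.1 i i = 1) :
    A = uni (A.1 0 1) (A.1 0 2) (A.1 0 3) (A.1 1 2) (A.1 1 3) (A.1 2 3) := by
  apply Subtype.ext
  ext i j
  fin_cases i <;> fin_cases j <;> simp [uni, h1] <;> exact h _ _ (by decide)

theorem isAlgHom_omegaStar (d₁ d₂ : ℤ) : IsAlgHom k (omegaStar (k := k) d₁ d₂) where
  map_mul x y := by
    apply Subtype.ext
    rw [Matrix.SpecialLinearGroup.coe_mul]
    simp only [omegaStar, Matrix.diagonal_mul_diagonal]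
    congr 1
    funext i
    fin_cases i <;> simp [mul_zpow, mul_comm]
  isMorphism := by
    rw [isMorphism_SLn_iff]
    intro i j
    by_cases hij : i = j
    · subst hij
      fin_cases i
      · exact exists_eval_eq_zpow d₁
      · exact exists_eval_eq_zpow d₂
      · exact exists_eval_eq_zpow (-d₂)
      · exact exists_eval_eq_zpow (-d₁)
    · exact ⟨0, fun x => by simp [omegaStar, Matrix.diagonal_apply_ne _ hij]⟩

theorem omegaStar_eq_diagonal (d₁ d₂ : ℤ) (u : Gm k) :
    (omegaStar d₁ d₂ u).1 =
      Matrix.diagonal fun i => ((u ^ ![d₁, d₂, -d₂, -d₁] i : kˣ) : k) := by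
  simp only [omegaStar]
  congr 1
  funext i
  fin_cases i <;> simp

theorem omegaStar_mem_Omega {d₁ d₂ : ℤ} (h₂ : 0 ≤ d₂) (h₁ : d₂ ≤ d₁) :
    omegaStar d₁ d₂ ∈ Omega k 4 := by
  refine ⟨![d₁, d₂, -d₂, -d₁], ?_, ?_, omegaStar_eq_diagonal d₁ d₂⟩
  · rw [Fin.antitone_iff_succ_le]
    intro i
    fin_cases i <;> simp <;> omega
  · intro i
    fin_cases i <;> simp [Fin.rev]

theorem exists_eq_omegaStar {ω : Gm k → SLn k 4} (h : ω ∈ Omega k 4) :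
    ∃ d₁ d₂ : ℤ, 0 ≤ d₂ ∧ d₂ ≤ d₁ ∧ ω = omegaStar d₁ d₂ := by
  obtain ⟨d, hd, hrev, hω⟩ := h
  have h2 : d 2 = - d 1 := hrev 2
  have h3 : d 3 = - d 0 := hrev 3
  have h12 : d 2 ≤ d 1 := hd (by decide)
  have h01 : d 1 ≤ d 0 := hd (by decide)
  refine ⟨d 0, d 1, by omega, h01, ?_⟩
  funext u
  apply Subtype.ext
  rw [hω]
  simp only [omegaStar]
  congr 1
  funext i
  fin_cases i <;> simp [h2, h3]

/-- Conjugation by diag(u^{d_i}) scales the (i, j) entry by u^{d_i - d_j}; these differences are the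
weights required in `IsPair.isRepPair`. -/
theorem omegaStar_mul_uni {d₁ d₂ : ℤ} (u : Gm k) {a b c d e f a' b' c' d' e' f' : k} :
    uni a' b' c' d' e' f' * omegaStar d₁ d₂ u = omegaStar d₁ d₂ u * uni a b c d e f ↔
      a' = ((u ^ (d₁ - d₂) : kˣ) : k) * a ∧ b' = ((u ^ (d₁ + d₂) : kˣ) : k) * b ∧
      c' = ((u ^ (2 * d₁) : kˣ) : k) * c ∧ d' = ((u ^ (2 * d₂) : kˣ) : k) * d ∧
      e' = ((u ^ (d₁ + d₂) : kˣ) : k) * e ∧ f' = ((u ^ (d₁ - d₂) : kˣ) : k) * f := by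
  have h1 : ((u ^ d₁ : kˣ) : k) ≠ 0 := (u ^ d₁).ne_zero
  have h2 : ((u ^ d₂ : kˣ) : k) ≠ 0 := (u ^ d₂).ne_zero
  have aux : uni a' b' c' d' e' f' * omegaStar d₁ d₂ u = omegaStar d₁ d₂ u * uni a b c d e f ↔
      a' * ((u ^ d₂ : kˣ) : k) = ((u ^ d₁ : kˣ) : k) * a ∧
      b' * ((u ^ d₂ : kˣ) : k)⁻¹ = ((u ^ d₁ : kˣ) : k) * b ∧
      c' * ((u ^ d₁ : kˣ) : k)⁻¹ = ((u ^ d₁ : kˣ) : k) * c ∧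
      d' * ((u ^ d₂ : kˣ) : k)⁻¹ = ((u ^ d₂ : kˣ) : k) * d ∧
      e' * ((u ^ d₁ : kˣ) : k)⁻¹ = ((u ^ d₂ : kˣ) : k) * e ∧
      f' * ((u ^ d₁ : kˣ) : k)⁻¹ = ((u ^ d₂ : kˣ) : k)⁻¹ * f := by
    constructor
    · intro h
      have h' := fun i j => congrFun (congrFun (congrArg Subtype.val h) i) j
      simp only [Matrix.SpecialLinearGroup.coe_mul] at h'
      simp only [omegaStar, Matrix.mul_diagonal, Matrix.diagonal_mul] at h'
      exact ⟨by simpa [uni] using h' 0 1, by simpa [uni] using h' 0 2,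
        by simpa [uni] using h' 0 3, by simpa [uni] using h' 1 2, by simpa [uni] using h' 1 3,
        by simpa [uni] using h' 2 3⟩
    · intro h
      simp only [Units.val_zpow_eq_zpow_val] at h
      apply Subtype.ext
      ext i j
      rw [Matrix.SpecialLinearGroup.coe_mul, Matrix.SpecialLinearGroup.coe_mul]
      simp only [omegaStar, Matrix.mul_diagonal, Matrix.diagonal_mul]
      fin_cases i <;> fin_cases j <;> simp [uni, h]
  rw [aux]
  simp only [zpow_add, zpow_sub, two_mul, Units.val_mul, Units.val_inv_eq_inv_val]
  set x := ((u ^ d₁ : kˣ) : k)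
  set y := ((u ^ d₂ : kˣ) : k)
  refine and_congr ?_ (and_congr ?_ (and_congr ?_ (and_congr ?_ (and_congr ?_ ?_))))
  all_goals field_simp

/-- A pair of maps whose product defines a representation, in normalised shape. -/
def IsRepPair (φ : Ga k → SLn k 4) (ω : Gm k → SLn k 4) : Prop :=
  φ ∈ UnipotentUpper k 4 ∧ ω ∈ Omega k 4 ∧ IsAlgHom k ω ∧ IsAlgHom k (psiOf φ ω)

/-- `t ↦ uni (a₁₂ t) …` is additive, entry by entry. -/
def UniAdditive (a₁₂ a₁₃ a₁₄ a₂₃ a₂₄ a₃₄ : k → k) : Prop :=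
  ∀ s t : k, a₁₂ (s + t) = a₁₂ t + a₁₂ s ∧ a₁₃ (s + t) = a₁₃ t + a₁₂ s * a₂₃ t + a₁₃ s ∧
    a₁₄ (s + t) = a₁₄ t + a₁₂ s * a₂₄ t + a₁₃ s * a₃₄ t + a₁₄ s ∧
    a₂₃ (s + t) = a₂₃ t + a₂₃ s ∧ a₂₄ (s + t) = a₂₄ t + a₂₃ s * a₃₄ t + a₂₄ s ∧
    a₃₄ (s + t) = a₃₄ t + a₃₄ s

/-- Given that φ and ω are multiplicative, so is φ(t)ω(u) once φ(u²t)ω(u) = ω(u)φ(t). The weights of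
the entries give exactly this relation, so each form needs only a check of degrees and of the
additivity identities. -/
theorem IsPair.isRepPair {φ : Ga k → SLn k 4} {ω : Gm k → SLn k 4} {d₁ d₂ : ℤ}
    {a₁₂ a₁₃ a₁₄ a₂₃ a₂₄ a₃₄ : k → k}
    (h : IsPair φ ω d₁ d₂ fun t => uni (a₁₂ t) (a₁₃ t) (a₁₄ t) (a₂₃ t) (a₂₄ t) (a₃₄ t))
    (h₂ : 0 ≤ d₂) (h₁ : d₂ ≤ d₁) (h₁₂ : Homog (d₁ - d₂) a₁₂) (h₁₃ : Homog (d₁ + d₂) a₁₃)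
    (h₁₄ : Homog (2 * d₁) a₁₄) (h₂₃ : Homog (2 * d₂) a₂₃) (h₂₄ : Homog (d₁ + d₂) a₂₄)
    (h₃₄ : Homog (d₁ - d₂) a₃₄) (hadd : UniAdditive a₁₂ a₁₃ a₁₄ a₂₃ a₂₄ a₃₄) :
    IsRepPair φ ω := by
  obtain ⟨hφ, rfl⟩ := h
  have hmul : ∀ s t, φ (s * t) = φ s * φ t := by
    intro s t
    rw [hφ, hφ, hφ, uni_mul, toAdd_mul, uni_inj]
    exact hadd _ _
  have hmor : IsMorphism k φ := by
    have hX : ∀ {w : ℤ} {f : k → k}, Homog w f → ∃ P : MvPolynomial (Fin 1) k,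
        ∀ t : Ga k, f t.toAdd = MvPolynomial.eval (AffineCoords.coord t) P := by
      rintro w f ⟨c, m, hf, -⟩
      exact ⟨MvPolynomial.C c * MvPolynomial.X 0 ^ m, fun t => by
        simp [hf, AffineCoords.coord]⟩
    have h0 : ∃ P : MvPolynomial (Fin 1) k,
        ∀ t : Ga k, 0 = MvPolynomial.eval (AffineCoords.coord t) P := ⟨0, by simp⟩
    have h1 : ∃ P : MvPolynomial (Fin 1) k,
        ∀ t : Ga k, 1 = MvPolynomial.eval (AffineCoords.coord t) P := ⟨1, by simp⟩
    rw [isMorphism_SLn_iff]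
    intro i j
    simp only [hφ]
    fin_cases i <;> fin_cases j
    exacts [h1, hX h₁₂, hX h₁₃, hX h₁₄, h0, h1, hX h₂₃, hX h₂₄, h0, h0, h1, hX h₃₄, h0, h0, h0, h1]
  refine ⟨⟨⟨hmul, hmor⟩, fun t => ?_⟩, omegaStar_mem_Omega h₂ h₁, isAlgHom_omegaStar d₁ d₂,
    fun x y => ?_, ?_⟩
  · rw [hφ]
    refine ⟨fun i j hij => ?_, fun i => ?_⟩
    · fin_cases i <;> fin_cases j <;> simp [uni] at hij ⊢
    · fin_cases i <;> simp [uni]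
  · have hw := (isAlgHom_omegaStar (k := k) d₁ d₂).map_mul
    rw [GaGm.mul_def]
    simp only [psiOf]
    rw [ofAdd_add, hmul, hw, ofAdd_toAdd]
    have : φ (.ofAdd ((x.right : k) ^ 2 * y.left.toAdd)) * omegaStar d₁ d₂ x.right =
        omegaStar d₁ d₂ x.right * φ y.left := by
      rw [hφ, hφ, omegaStar_mul_uni, toAdd_ofAdd]
      exact ⟨h₁₂.apply_sq_mul _ _, h₁₃.apply_sq_mul _ _, h₁₄.apply_sq_mul _ _,
        h₂₃.apply_sq_mul _ _, h₂₄.apply_sq_mul _ _, h₃₄.apply_sq_mul _ _⟩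
    rw [mul_assoc, ← mul_assoc _ (omegaStar d₁ d₂ x.right), this]
    simp only [mul_assoc]
  · exact (hmor.comp isMorphism_left).mul
      ((isAlgHom_omegaStar d₁ d₂).isMorphism.comp isMorphism_right)

end Uni



/-! ### Small integers in characteristic p -/

section Characteristic

variable {k : Type*} [Field k] (p : ℕ) [CharP k p]

theorem natCast_ne_zero_of_lt {m : ℕ} (h0 : m ≠ 0) (h : m < p) : (m : k) ≠ 0 := fun h' =>
  absurd (Nat.le_of_dvd (Nat.pos_of_ne_zero h0) ((CharP.cast_eq_zero_iff k p m).1 h'))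
    (not_le.2 h)

theorem ne_of_natCast_ne_zero {m : ℕ} (h : (m : k) ≠ 0) : p ≠ m := by
  rintro rfl
  exact h (CharP.cast_eq_zero k p)

theorem two_ne_zero_of_three_le (h : 3 ≤ p) : (2 : k) ≠ 0 :=
  natCast_ne_zero_of_lt p (m := 2) two_ne_zero (by omega)

theorem three_ne_zero_of_five_le (h : 5 ≤ p) : (3 : k) ≠ 0 :=
  natCast_ne_zero_of_lt p (m := 3) three_ne_zero (by omega)

end Characteristic

/-! ### The 26 forms are representations -/

section Forms

variable {k : Type*} [Field k] (p : ℕ) [Fact p.Prime]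

theorem prime_pow_lt_pow {a b : ℕ} (h : a < b) : (p : ℤ) ^ a < (p : ℤ) ^ b :=
  pow_lt_pow_right₀ (by exact_mod_cast (Fact.out : p.Prime).one_lt) h

theorem prime_pow_le_pow {a b : ℕ} (h : a ≤ b) : (p : ℤ) ^ a ≤ (p : ℤ) ^ b :=
  pow_le_pow_right₀ (by exact_mod_cast (Fact.out : p.Prime).one_lt.le) h

theorem two_mul_prime_pow_le_pow {a b : ℕ} (h : a + 1 ≤ b) : 2 * (p : ℤ) ^ a ≤ (p : ℤ) ^ b := by
  refine le_trans ?_ (prime_pow_le_pow p h)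
  rw [pow_succ, mul_comm]
  exact mul_le_mul_of_nonneg_left (by exact_mod_cast (Fact.out : p.Prime).two_le) (by positivity)

theorem prime_pow_pos (a : ℕ) : 0 < (p : ℤ) ^ a :=
  pow_pos (by exact_mod_cast (Fact.out : p.Prime).pos) a

variable {p} [CharP k p] {φ : Ga k → SLn k 4} {ω : Gm k → SLn k 4}

/-- After expanding by Frobenius, additivity is a polynomial identity in s^q and t^q, with 2 or 6
inverted where they occur as denominators. In (II), (VII) and (XXI) the prescribed characteristic is
what gives t^{p^{e₁+1}} the degree 3q₁ or 2q₁ that the other entries impose. -/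
theorem HasForm.isRepPair : ∀ {ν : Label}, HasForm p φ ω ν → IsRepPair φ ω
  | .I, h => by
    obtain ⟨hp, e₁, h⟩ := h
    have h2 := two_ne_zero_of_three_le (k := k) p (by omega)
    have h3 := three_ne_zero_of_five_le (k := k) p hp
    have h6 : (6 : k) ≠ 0 := by
      rw [show (6 : k) = 2 * 3 by norm_num]
      exact mul_ne_zero h2 h3
    have hq := prime_pow_pos p e₁
    refine h.isRepPair (by omega) (by omega)
      (homog_pow (by push_cast; ring)) (homog_mul_pow _ (by push_cast; ring))
      (homog_mul_pow _ (by push_cast; ring)) (homog_pow (by push_cast; ring))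
      (homog_mul_pow _ (by push_cast; ring)) (homog_pow (by push_cast; ring)) fun s t => ?_
    simp only [pow_mul', add_pow_char_pow]
    refine ⟨?_, ?_, ?_, ?_, ?_, ?_⟩ <;> field_simp <;> ring
  | .II, h => by
    obtain ⟨rfl, e₁, h⟩ := h
    have h2 := two_ne_zero_of_three_le (k := k) 3 le_rfl
    have h3 : (3 : k) = 0 := CharP.cast_eq_zero k 3
    have hq := prime_pow_pos 3 e₁
    have hq' := prime_pow_le_pow 3 (Nat.le_succ e₁)
    refine h.isRepPair hq.le hq'
      (homog_pow (by push_cast; ring)) (homog_mul_pow _ (by push_cast; ring))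
      (homog_pow (by push_cast; ring)) (homog_pow (by push_cast; ring))
      (homog_zero _) (homog_zero _) fun s t => ?_
    simp only [pow_mul', add_pow_char_pow]
    refine ⟨?_, ?_, ?_, ?_, ?_, ?_⟩ <;> field_simp <;> ring
  | .III, h => by
    obtain ⟨hp, e₁, h⟩ := h
    have h2 := two_ne_zero_of_three_le (k := k) p hp
    have hq := prime_pow_pos p e₁
    refine h.isRepPair (by omega) (by omega)
      (homog_pow (by push_cast; ring)) (homog_mul_pow _ (by push_cast; ring))
      (homog_zero _) (homog_pow (by push_cast; ring))
      (homog_zero _) (homog_zero _) fun s t => ?_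
    simp only [pow_mul', add_pow_char_pow]
    refine ⟨?_, ?_, ?_, ?_, ?_, ?_⟩ <;> field_simp <;> ring
  | .IV, h => by
    obtain ⟨e₁, e₂, he, h⟩ := h
    have hlt := prime_pow_lt_pow p (show e₁ < e₂ by omega)
    have hq := prime_pow_pos p e₁
    refine h.isRepPair (by omega) (by omega)
      (homog_pow (by push_cast; ring)) (homog_pow (by push_cast; ring))
      (homog_pow (by push_cast; ring)) (homog_zero _)
      (homog_pow (by push_cast; ring)) (homog_pow (by push_cast; ring)) fun s t => ?_
    simp only [pow_add s, pow_add t, pow_add (s + t), add_pow_char_pow]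
    refine ⟨?_, ?_, ?_, ?_, ?_, ?_⟩ <;> ring
  | .V, h => by
    obtain ⟨e₁, f, he, h⟩ := h
    have hle := two_mul_prime_pow_le_pow p (show e₁ + 1 ≤ f by omega)
    have hq := prime_pow_pos p e₁
    refine h.isRepPair (by omega) (by omega)
      (homog_pow (by push_cast; ring)) (homog_zero _)
      (homog_pow (by push_cast; ring)) (homog_zero _)
      (homog_zero _) (homog_pow (by push_cast; ring)) fun s t => ?_
    simp only [add_pow_char_pow]
    refine ⟨?_, ?_, ?_, ?_, ?_, ?_⟩ <;> ring
  | .VI, h => by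
    obtain ⟨e₁, d₂, hd, h⟩ := h
    have hq := prime_pow_pos p e₁
    refine h.isRepPair (by omega) (by omega)
      (homog_pow (by push_cast; ring)) (homog_zero _)
      (homog_zero _) (homog_zero _)
      (homog_zero _) (homog_pow (by push_cast; ring)) fun s t => ?_
    simp only [add_pow_char_pow]
    refine ⟨?_, ?_, ?_, ?_, ?_, ?_⟩ <;> ring
  | .VII, h => by
    obtain ⟨rfl, e₁, h⟩ := h
    have h2 := two_ne_zero_of_three_le (k := k) 3 le_rfl
    have hq := prime_pow_pos 3 e₁
    have hq' := prime_pow_le_pow 3 (Nat.le_succ e₁)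
    refine h.isRepPair hq.le hq'
      (homog_zero _) (homog_zero _)
      (homog_pow (by push_cast; ring)) (homog_pow (by push_cast; ring))
      (homog_mul_pow _ (by push_cast; ring)) (homog_pow (by push_cast; ring)) fun s t => ?_
    simp only [pow_mul', add_pow_char_pow]
    refine ⟨?_, ?_, ?_, ?_, ?_, ?_⟩ <;> field_simp <;> ring
  | .VIII, h => by
    obtain ⟨hp, e₁, h⟩ := h
    have h2 := two_ne_zero_of_three_le (k := k) p hp
    have hq := prime_pow_pos p e₁
    refine h.isRepPair (by omega) (by omega)
      (homog_zero _) (homog_zero _)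
      (homog_zero _) (homog_pow (by push_cast; ring))
      (homog_mul_pow _ (by push_cast; ring)) (homog_pow (by push_cast; ring)) fun s t => ?_
    simp only [pow_mul', add_pow_char_pow]
    refine ⟨?_, ?_, ?_, ?_, ?_, ?_⟩ <;> field_simp <;> ring
  | .IX, h => by
    obtain ⟨hp, e₁, h⟩ := h
    have h2 := two_ne_zero_of_three_le (k := k) p hp
    have hq := prime_pow_pos p e₁
    refine h.isRepPair (by omega) (by omega)
      (homog_pow (by push_cast; ring)) (homog_zero _)
      (homog_mul_pow _ (by push_cast; ring)) (homog_zero _)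
      (homog_pow (by push_cast; ring)) (homog_zero _) fun s t => ?_
    simp only [pow_mul', add_pow_char_pow]
    refine ⟨?_, ?_, ?_, ?_, ?_, ?_⟩ <;> field_simp <;> ring
  | .X, h => by
    obtain ⟨e₁, e₂, he, h⟩ := h
    have hlt := prime_pow_lt_pow p (show e₁ < e₂ by omega)
    have hq := prime_pow_pos p e₁
    refine h.isRepPair (by omega) (by omega)
      (homog_pow (by push_cast; ring)) (homog_pow (by push_cast; ring))
      (homog_zero _) (homog_zero _)
      (homog_zero _) (homog_zero _) fun s t => ?_
    simp only [add_pow_char_pow]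
    refine ⟨?_, ?_, ?_, ?_, ?_, ?_⟩ <;> ring
  | .XI, h => by
    obtain ⟨e₁, e₃, he, h⟩ := h
    have hle := two_mul_prime_pow_le_pow p (show e₁ + 1 ≤ e₃ by omega)
    have hq := prime_pow_pos p e₁
    refine h.isRepPair (by omega) (by omega)
      (homog_pow (by push_cast; ring)) (homog_zero _)
      (homog_pow (by push_cast; ring)) (homog_zero _)
      (homog_zero _) (homog_zero _) fun s t => ?_
    simp only [add_pow_char_pow]
    refine ⟨?_, ?_, ?_, ?_, ?_, ?_⟩ <;> ring
  | .XII, h => by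
    obtain ⟨e₁, d₂, hd, h⟩ := h
    have hq := prime_pow_pos p e₁
    refine h.isRepPair (by omega) (by omega)
      (homog_pow (by push_cast; ring)) (homog_zero _)
      (homog_zero _) (homog_zero _)
      (homog_zero _) (homog_zero _) fun s t => ?_
    simp only [add_pow_char_pow]
    refine ⟨?_, ?_, ?_, ?_, ?_, ?_⟩ <;> ring
  | .XIII, h => by
    obtain ⟨e₁, e₃, he, h⟩ := h
    have hlt := prime_pow_lt_pow p (show e₃ < e₁ by omega)
    have hq := prime_pow_pos p e₃
    refine h.isRepPair (by omega) (by omega)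
      (homog_zero _) (homog_pow (by push_cast; ring))
      (homog_zero _) (homog_pow (by push_cast; ring))
      (homog_pow (by push_cast; ring)) (homog_zero _) fun s t => ?_
    simp only [add_pow_char_pow]
    refine ⟨?_, ?_, ?_, ?_, ?_, ?_⟩ <;> ring
  | .XIV, h => by
    obtain ⟨e₁, e₃, he, h⟩ := h
    have hlt := prime_pow_lt_pow p (show e₃ < e₁ by omega)
    have hq := prime_pow_pos p e₃
    refine h.isRepPair (by omega) (by omega)
      (homog_zero _) (homog_pow (by push_cast; ring))
      (homog_zero _) (homog_pow (by push_cast; ring))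
      (homog_zero _) (homog_zero _) fun s t => ?_
    simp only [add_pow_char_pow]
    refine ⟨?_, ?_, ?_, ?_, ?_, ?_⟩ <;> ring
  | .XV, h => by
    obtain ⟨e₂, e₃, he, h⟩ := h
    have hle := prime_pow_le_pow p (show e₃ ≤ e₂ by omega)
    have hq := prime_pow_pos p e₃
    refine h.isRepPair (by omega) (by omega)
      (homog_zero _) (homog_zero _)
      (homog_pow (by push_cast; ring)) (homog_pow (by push_cast; ring))
      (homog_zero _) (homog_zero _) fun s t => ?_
    simp only [add_pow_char_pow]
    refine ⟨?_, ?_, ?_, ?_, ?_, ?_⟩ <;> ring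
  | .XVI, h => by
    obtain ⟨e₃, e₄, he, h⟩ := h
    have hlt := prime_pow_lt_pow p (show e₃ < e₄ by omega)
    have hq := prime_pow_pos p e₃
    refine h.isRepPair (by omega) (by omega)
      (homog_zero _) (homog_zero _)
      (homog_zero _) (homog_pow (by push_cast; ring))
      (homog_pow (by push_cast; ring)) (homog_zero _) fun s t => ?_
    simp only [add_pow_char_pow]
    refine ⟨?_, ?_, ?_, ?_, ?_, ?_⟩ <;> ring
  | .XVII, h => by
    obtain ⟨e₃, d₁, hd, h⟩ := h
    have hq := prime_pow_pos p e₃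
    refine h.isRepPair (by omega) (by omega)
      (homog_zero _) (homog_zero _)
      (homog_zero _) (homog_pow (by push_cast; ring))
      (homog_zero _) (homog_zero _) fun s t => ?_
    simp only [add_pow_char_pow]
    refine ⟨?_, ?_, ?_, ?_, ?_, ?_⟩ <;> ring
  | .XVIII, h => by
    obtain ⟨e₁, e₂, he, h⟩ := h
    have hlt := prime_pow_lt_pow p (show e₁ < e₂ by omega)
    have hq := prime_pow_pos p e₁
    refine h.isRepPair (by omega) (by omega)
      (homog_zero _) (homog_zero _)
      (homog_zero _) (homog_zero _)
      (homog_pow (by push_cast; ring)) (homog_pow (by push_cast; ring)) fun s t => ?_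
    simp only [add_pow_char_pow]
    refine ⟨?_, ?_, ?_, ?_, ?_, ?_⟩ <;> ring
  | .XIX, h => by
    obtain ⟨e₁, e₃, he, h⟩ := h
    have hle := two_mul_prime_pow_le_pow p (show e₁ + 1 ≤ e₃ by omega)
    have hq := prime_pow_pos p e₁
    refine h.isRepPair (by omega) (by omega)
      (homog_zero _) (homog_zero _)
      (homog_pow (by push_cast; ring)) (homog_zero _)
      (homog_zero _) (homog_pow (by push_cast; ring)) fun s t => ?_
    simp only [add_pow_char_pow]
    refine ⟨?_, ?_, ?_, ?_, ?_, ?_⟩ <;> ring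
  | .XX, h => by
    obtain ⟨e₁, d₂, hd, h⟩ := h
    have hq := prime_pow_pos p e₁
    refine h.isRepPair (by omega) (by omega)
      (homog_zero _) (homog_zero _)
      (homog_zero _) (homog_zero _)
      (homog_zero _) (homog_pow (by push_cast; ring)) fun s t => ?_
    simp only [add_pow_char_pow]
    refine ⟨?_, ?_, ?_, ?_, ?_, ?_⟩ <;> ring
  | .XXI, h => by
    obtain ⟨rfl, e₁, h⟩ := h
    have hq := prime_pow_pos 2 (e₁ + 1)
    have h2 : (2 : k) = 0 := CharP.cast_eq_zero k 2
    refine h.isRepPair le_rfl hq.le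
      (homog_zero _) (homog_pow (by push_cast; ring))
      (homog_pow (by push_cast; ring)) (homog_zero _)
      (homog_pow (by push_cast; ring)) (homog_zero _) fun s t => ?_
    simp only [add_pow_char_pow]
    refine ⟨?_, ?_, ?_, ?_, ?_, ?_⟩ <;> ring
  | .XXII, h => by
    obtain ⟨e₁, d₁, hd, hd', h⟩ := h
    refine h.isRepPair (by omega) (by omega)
      (homog_zero _) (homog_pow (by push_cast; ring))
      (homog_zero _) (homog_zero _)
      (homog_pow (by push_cast; ring)) (homog_zero _) fun s t => ?_
    simp only [add_pow_char_pow]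
    refine ⟨?_, ?_, ?_, ?_, ?_, ?_⟩ <;> ring
  | .XXIII, h => by
    obtain ⟨e₁, d₁, hd, hd', h⟩ := h
    refine h.isRepPair (by omega) (by omega)
      (homog_zero _) (homog_pow (by push_cast; ring))
      (homog_zero _) (homog_zero _)
      (homog_zero _) (homog_zero _) fun s t => ?_
    simp only [add_pow_char_pow]
    refine ⟨?_, ?_, ?_, ?_, ?_, ?_⟩ <;> ring
  | .XXIV, h => by
    obtain ⟨e₂, d₂, hd, hd', h⟩ := h
    refine h.isRepPair (by omega) (by omega)
      (homog_zero _) (homog_zero _)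
      (homog_pow (by push_cast; ring)) (homog_zero _)
      (homog_zero _) (homog_zero _) fun s t => ?_
    simp only [add_pow_char_pow]
    refine ⟨?_, ?_, ?_, ?_, ?_, ?_⟩ <;> ring
  | .XXV, h => by
    obtain ⟨e₃, d₁, hd, hd', h⟩ := h
    refine h.isRepPair (by omega) (by omega)
      (homog_zero _) (homog_zero _)
      (homog_zero _) (homog_zero _)
      (homog_pow (by push_cast; ring)) (homog_zero _) fun s t => ?_
    simp only [add_pow_char_pow]
    refine ⟨?_, ?_, ?_, ?_, ?_, ?_⟩ <;> ring
  | .XXVI, h => by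
    obtain ⟨d₁, d₂, hd, hd', h⟩ := h
    rw [← uni_zero] at h
    exact h.isRepPair hd hd' (homog_zero _) (homog_zero _) (homog_zero _) (homog_zero _)
      (homog_zero _) (homog_zero _) fun s t => by simp

end Forms



/-! ### Conjugation by the centraliser of ω -/

section Conjugation

variable {k : Type*} [Field k] {p : ℕ}

/-- Inverse-free form of the equivalence: an invertible matrix intertwining both factors intertwines
their product. -/
theorem pairEquiv_of_matrix {n : ℕ} {φ φ' : Ga k → SLn k n} {ω ω' : Gm k → SLn k n}
    (P : Matrix (Fin n) (Fin n) k) (hP : P.det ≠ 0)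
    (hφ : ∀ t, (φ t).1 * P = P * (φ' t).1) (hω : ∀ u, (ω u).1 * P = P * (ω' u).1) :
    PairEquiv φ ω φ' ω' := by
  refine ⟨Matrix.GeneralLinearGroup.mkOfDetNeZero P hP, funext fun x => Subtype.ext ?_⟩
  set Q := Matrix.GeneralLinearGroup.mkOfDetNeZero P hP
  have hQ : Q.1 = P := rfl
  change (Q⁻¹).1 * ((φ x.left).1 * (ω x.right).1) * Q.1 = (φ' x.left).1 * (ω' x.right).1
  rw [mul_assoc, mul_assoc, hQ, hω, ← mul_assoc _ P, hφ, ← hQ, mul_assoc, ← mul_assoc, Units.inv_mul,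
    one_mul]

/-- The pair `(φ, ω)` is equivalent to one of the listed forms. -/
def Classified (p : ℕ) (φ : Ga k → SLn k 4) (ω : Gm k → SLn k 4) : Prop :=
  ∃ (φ' : Ga k → SLn k 4) (ω' : Gm k → SLn k 4),
    PairEquiv φ ω φ' ω' ∧ ∃ ν : Label, HasForm p φ' ω' ν

/-- The unitriangular matrix function with monomial entries, of exponents `m, r, l` in the first
row and `n, r, m` below. -/
def mono (m r l n : ℕ) (c₁₂ c₁₃ c₁₄ c₂₃ c₂₄ c₃₄ : k) (t : Ga k) : SLn k 4 :=
  uni (c₁₂ * t.toAdd ^ m) (c₁₃ * t.toAdd ^ r) (c₁₄ * t.toAdd ^ l) (c₂₃ * t.toAdd ^ n)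
    (c₂₄ * t.toAdd ^ r) (c₃₄ * t.toAdd ^ m)

variable {m r l n : ℕ} {c₁₂ c₁₃ c₁₄ c₂₃ c₂₄ c₃₄ : k} {d₁ d₂ : ℤ}

/-- Diagonal matrices commute with every ω* and replace c_ij by c_ij x_j / x_i, so they rescale
constants without changing exponents. -/
theorem Classified.of_diagonal (ν : Label) (b₁₂ b₁₃ b₁₄ b₂₃ b₂₄ b₃₄ x₁ x₂ x₃ x₄ : k)
    (hf : HasForm p (mono m r l n b₁₂ b₁₃ b₁₄ b₂₃ b₂₄ b₃₄) (omegaStar d₁ d₂) ν)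
    (hx : x₁ ≠ 0 ∧ x₂ ≠ 0 ∧ x₃ ≠ 0 ∧ x₄ ≠ 0)
    (h : c₁₂ * x₂ = x₁ * b₁₂ ∧ c₁₃ * x₃ = x₁ * b₁₃ ∧ c₁₄ * x₄ = x₁ * b₁₄ ∧
      c₂₃ * x₃ = x₂ * b₂₃ ∧ c₂₄ * x₄ = x₂ * b₂₄ ∧ c₃₄ * x₄ = x₃ * b₃₄) :
    Classified p (mono m r l n c₁₂ c₁₃ c₁₄ c₂₃ c₂₄ c₃₄) (omegaStar d₁ d₂) := by
  refine ⟨_, _, pairEquiv_of_matrix (Matrix.diagonal ![x₁, x₂, x₃, x₄]) ?_ ?_ ?_, ν, hf⟩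
  · rw [Matrix.det_diagonal, Fin.prod_univ_four]
    simp [hx]
  · intro t
    obtain ⟨h1, h2, h3, h4, h5, h6⟩ := h
    ext i j
    rw [Matrix.mul_diagonal, Matrix.diagonal_mul]
    fin_cases i <;> fin_cases j <;> simp [mono, uni]
    · linear_combination t.toAdd ^ m * h1
    · linear_combination t.toAdd ^ r * h2
    · linear_combination t.toAdd ^ l * h3
    · linear_combination t.toAdd ^ n * h4
    · linear_combination t.toAdd ^ r * h5
    · linear_combination t.toAdd ^ m * h6
  · intro u
    simp only [omegaStar, Matrix.diagonal_mul_diagonal]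
    congr 1
    funext i
    exact mul_comm _ _

/-- Conjugation by an element of `GL₁ × GL₂ × GL₁`, which commutes with `ω*` if `d₂ = 0`. -/
theorem Classified.of_middle_block (ν : Label) (b₁₂ b₁₃ b₁₄ b₂₄ b₃₄ x₁ x₄ g₁₁ g₁₂ g₂₁ g₂₂ : k)
    (hf : HasForm p (mono m m l n b₁₂ b₁₃ b₁₄ 0 b₂₄ b₃₄) (omegaStar d₁ 0) ν)
    (hx : x₁ ≠ 0 ∧ x₄ ≠ 0 ∧ g₁₁ * g₂₂ - g₁₂ * g₂₁ ≠ 0)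
    (h : c₁₂ * g₁₁ + c₁₃ * g₂₁ = x₁ * b₁₂ ∧ c₁₂ * g₁₂ + c₁₃ * g₂₂ = x₁ * b₁₃ ∧
      c₁₄ * x₄ = x₁ * b₁₄ ∧ c₂₄ * x₄ = g₁₁ * b₂₄ + g₁₂ * b₃₄ ∧
      c₃₄ * x₄ = g₂₁ * b₂₄ + g₂₂ * b₃₄) :
    Classified p (mono m m l n c₁₂ c₁₃ c₁₄ 0 c₂₄ c₃₄) (omegaStar d₁ 0) := by
  refine ⟨_, _, pairEquiv_of_matrix
    !![x₁, 0, 0, 0; 0, g₁₁, g₁₂, 0; 0, g₂₁, g₂₂, 0; 0, 0, 0, x₄] ?_ ?_ ?_, ν, hf⟩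
  · have : Matrix.det !![x₁, 0, 0, 0; 0, g₁₁, g₁₂, 0; 0, g₂₁, g₂₂, 0; 0, 0, 0, x₄] =
        x₁ * x₄ * (g₁₁ * g₂₂ - g₁₂ * g₂₁) := by
      simp [Matrix.det_succ_row_zero, Fin.sum_univ_succ, Fin.succAbove]
      ring
    rw [this]
    exact mul_ne_zero (mul_ne_zero hx.1 hx.2.1) hx.2.2
  · intro t
    obtain ⟨h1, h2, h3, h4, h5⟩ := h
    ext i j
    fin_cases i <;> fin_cases j <;>
      simp [mono, uni, Matrix.mul_apply, Fin.sum_univ_four]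
    · linear_combination t.toAdd ^ m * h1
    · linear_combination t.toAdd ^ m * h2
    · linear_combination t.toAdd ^ l * h3
    · linear_combination t.toAdd ^ m * h4
    · linear_combination t.toAdd ^ m * h5
  · intro u
    ext i j
    simp only [omegaStar, Matrix.diagonal_mul, Matrix.mul_diagonal]
    fin_cases i <;> fin_cases j <;> simp [mul_comm]

/-- Conjugation by an element of `GL₂ × GL₂`, which commutes with `ω*` if `d₁ = d₂`. -/
theorem Classified.of_two_blocks (ν : Label)
    (b₁₃ b₁₄ b₂₃ b₂₄ g₁₁ g₁₂ g₂₁ g₂₂ h₁₁ h₁₂ h₂₁ h₂₂ : k)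
    (hf : HasForm p (mono m n n n 0 b₁₃ b₁₄ b₂₃ b₂₄ 0) (omegaStar d₁ d₁) ν)
    (hx : g₁₁ * g₂₂ - g₁₂ * g₂₁ ≠ 0 ∧ h₁₁ * h₂₂ - h₁₂ * h₂₁ ≠ 0)
    (h : c₁₃ * h₁₁ + c₁₄ * h₂₁ = g₁₁ * b₁₃ + g₁₂ * b₂₃ ∧
      c₁₃ * h₁₂ + c₁₄ * h₂₂ = g₁₁ * b₁₄ + g₁₂ * b₂₄ ∧
      c₂₃ * h₁₁ + c₂₄ * h₂₁ = g₂₁ * b₁₃ + g₂₂ * b₂₃ ∧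
      c₂₃ * h₁₂ + c₂₄ * h₂₂ = g₂₁ * b₁₄ + g₂₂ * b₂₄) :
    Classified p (mono m n n n 0 c₁₃ c₁₄ c₂₃ c₂₄ 0) (omegaStar d₁ d₁) := by
  refine ⟨_, _, pairEquiv_of_matrix
    !![g₁₁, g₁₂, 0, 0; g₂₁, g₂₂, 0, 0; 0, 0, h₁₁, h₁₂; 0, 0, h₂₁, h₂₂] ?_ ?_ ?_, ν, hf⟩
  · have : Matrix.det !![g₁₁, g₁₂, 0, 0; g₂₁, g₂₂, 0, 0; 0, 0, h₁₁, h₁₂; 0, 0, h₂₁, h₂₂] =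
        (g₁₁ * g₂₂ - g₁₂ * g₂₁) * (h₁₁ * h₂₂ - h₁₂ * h₂₁) := by
      simp [Matrix.det_succ_row_zero, Fin.sum_univ_succ, Fin.succAbove]
      ring
    rw [this]
    exact mul_ne_zero hx.1 hx.2
  · intro t
    obtain ⟨h1, h2, h3, h4⟩ := h
    ext i j
    fin_cases i <;> fin_cases j <;>
      simp [mono, uni, Matrix.mul_apply, Fin.sum_univ_four]
    · linear_combination t.toAdd ^ n * h1
    · linear_combination t.toAdd ^ n * h2
    · linear_combination t.toAdd ^ n * h3
    · linear_combination t.toAdd ^ n * h4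
  · intro u
    ext i j
    simp only [omegaStar, Matrix.diagonal_mul, Matrix.mul_diagonal]
    fin_cases i <;> fin_cases j <;> simp [mul_comm]

end Conjugation



/-! ### Degenerate weights: d₁ = d₂ or d₂ = 0 -/

section Classification

variable {k : Type*} [Field k] (p : ℕ) [Fact p.Prime] [CharP k p]

theorem three_le_of_two_ne_zero (h : (2 : k) ≠ 0) : 3 ≤ p := by
  have h2 := (Fact.out : p.Prime).two_le
  have := ne_of_natCast_ne_zero p (m := 2) h
  omega

theorem five_le_of_three_ne_zero (h : (2 : k) ≠ 0) (h' : (3 : k) ≠ 0) : 5 ≤ p := by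
  have h2 := three_le_of_two_ne_zero p h
  have h3 := ne_of_natCast_ne_zero p (m := 3) h'
  have h4 : p ≠ 4 := by
    rintro rfl
    exact absurd (Fact.out : Nat.Prime 4) (by norm_num)
  omega

theorem eq_of_natCast_eq_zero {q : ℕ} (hq : q.Prime) (h : (q : k) = 0) : p = q :=
  (Nat.prime_dvd_prime_iff_eq Fact.out hq).1 ((CharP.cast_eq_zero_iff k p q).1 h)

theorem lt_of_prime_pow_lt {a b : ℕ} (h : p ^ a < p ^ b) : a < b :=
  (Nat.pow_lt_pow_iff_right (Fact.out : p.Prime).one_lt).1 h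

theorem le_of_prime_pow_le {a b : ℕ} (h : p ^ a ≤ p ^ b) : a ≤ b :=
  (Nat.pow_le_pow_iff_right (Fact.out : p.Prime).one_lt).1 h

/-- This gap between powers of p is what prevents a₁₄ from coexisting with an additive a₁₃ or a₂₄.
-/
theorem two_mul_le_of_prime_pow_lt {a b : ℕ} (h : p ^ a < p ^ b) : 2 * p ^ a ≤ p ^ b := by
  have := two_mul_prime_pow_le_pow p (lt_of_prime_pow_lt p h)
  exact_mod_cast this

variable {p} {m r l n : ℕ} {c₁₂ c₁₃ c₁₄ c₂₃ c₂₄ c₃₄ : k}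

/-- The function `t ↦ c * t ^ m` is additive. -/
def MonoAdditive (c : k) (m : ℕ) : Prop :=
  ∀ s t : k, c * (s + t) ^ m = c * s ^ m + c * t ^ m

theorem MonoAdditive.exists_eq_pow [IsAlgClosed k] {c : k} (h : MonoAdditive c m) (hc : c ≠ 0) :
    ∃ e : ℕ, m = p ^ e :=
  (eq_zero_or_eq_pow_of_additive p h).resolve_left hc

theorem isPair_mono {A : k → SLn k 4} {d₁ d₂ : ℤ}
    (h : ∀ t : Ga k, mono m r l n c₁₂ c₁₃ c₁₄ c₂₃ c₂₄ c₃₄ t = A t.toAdd)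
    (h₁ : (l : ℤ) = d₁) (h₂ : (n : ℤ) = d₂) :
    IsPair (mono m r l n c₁₂ c₁₃ c₁₄ c₂₃ c₂₄ c₃₄) (omegaStar (l : ℤ) (n : ℤ)) d₁ d₂ A :=
  ⟨h, congrArg₂ omegaStar h₁ h₂⟩

/-- The two entries share no row or column, so a diagonal matrix scales each to 1 independently. All
branches with no other entry end here, including odd d₁ - d₂. -/
theorem classified_of_c₁₄_c₂₃ [IsAlgClosed k] (h : n ≤ l) (h₁₄ : MonoAdditive c₁₄ l)
    (h₂₃ : MonoAdditive c₂₃ n) :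
    Classified p (mono m r l n 0 0 c₁₄ c₂₃ 0 0) (omegaStar (l : ℤ) (n : ℤ)) := by
  rcases eq_or_ne c₁₄ 0 with rfl | hc₁₄ <;> rcases eq_or_ne c₂₃ 0 with rfl | hc₂₃
  · refine Classified.of_diagonal .XXVI 0 0 0 0 0 0 1 1 1 1
      ⟨l, n, by omega, by omega, isPair_mono (fun t => ?_) rfl rfl⟩ (by simp) (by simp)
    simp [mono, uni_zero]
  · obtain ⟨e, he⟩ := h₂₃.exists_eq_pow (p := p) hc₂₃
    refine Classified.of_diagonal .XVII 0 0 0 1 0 0 1 c₂₃ 1 1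
      ⟨e, l, ?_, isPair_mono (fun t => ?_) rfl (by exact_mod_cast he)⟩ (by simp [hc₂₃]) (by simp)
    · exact_mod_cast he ▸ h
    · simp [mono, ← he]
  · obtain ⟨e, he⟩ := h₁₄.exists_eq_pow (p := p) hc₁₄
    refine Classified.of_diagonal .XXIV 0 0 1 0 0 0 c₁₄ 1 1 1
      ⟨e, n, by omega, ?_, isPair_mono (fun t => ?_) (by exact_mod_cast he) rfl⟩ (by simp [hc₁₄])
      (by simp)
    · exact_mod_cast he ▸ h
    · simp [mono, ← he]
  · obtain ⟨e, he⟩ := h₂₃.exists_eq_pow (p := p) hc₂₃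
    obtain ⟨f, hf⟩ := h₁₄.exists_eq_pow (p := p) hc₁₄
    refine Classified.of_diagonal .XV 0 0 1 1 0 0 c₁₄ c₂₃ 1 1
      ⟨f, e, le_of_prime_pow_le p (by omega), isPair_mono (fun t => ?_) (by exact_mod_cast hf)
        (by exact_mod_cast he)⟩ (by simp [hc₁₄, hc₂₃]) (by simp)
    simp [mono, ← he, ← hf]

/-- Used to complete a nonzero vector of k² to an invertible 2×2 matrix. -/
theorem exists_mul_add_mul_eq_one {a b : k} (h : a ≠ 0 ∨ b ≠ 0) : ∃ x y, a * x + b * y = 1 := by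
  rcases h with h | h
  · exact ⟨a⁻¹, 0, by simp [h]⟩
  · exact ⟨0, b⁻¹, by simp [h]⟩

theorem exists_rank_one {a b c d : k} (hdet : a * d - b * c = 0)
    (h : a ≠ 0 ∨ b ≠ 0 ∨ c ≠ 0 ∨ d ≠ 0) :
    ∃ x₁ x₂ y₁ y₂ : k, (x₁ ≠ 0 ∨ x₂ ≠ 0) ∧ (y₁ ≠ 0 ∨ y₂ ≠ 0) ∧
      a = x₁ * y₁ ∧ b = x₁ * y₂ ∧ c = x₂ * y₁ ∧ d = x₂ * y₂ := by
  by_cases ha : a = 0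
  · by_cases hb : b = 0
    · exact ⟨0, 1, c, d, by simp, by simpa [ha, hb] using h, by simp [ha], by simp [hb], by simp,
        by simp⟩
    · exact ⟨1, d / b, a, b, by simp, .inr hb, by simp, by simp, by field_simp; linear_combination -hdet,
        by field_simp⟩
  · exact ⟨1, c / a, a, b, by simp, .inl ha, by simp, by simp, by field_simp,
      by field_simp; linear_combination hdet⟩

/-- The case `d₁ = d₂`. -/
theorem classified_of_d₁_eq_d₂ [IsAlgClosed k] (h₁₃ : MonoAdditive c₁₃ n) (h₁₄ : MonoAdditive c₁₄ n)
    (h₂₃ : MonoAdditive c₂₃ n) (h₂₄ : MonoAdditive c₂₄ n) :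
    Classified p (mono m n n n 0 c₁₃ c₁₄ c₂₃ c₂₄ 0) (omegaStar (n : ℤ) (n : ℤ)) := by
  by_cases h : c₁₃ ≠ 0 ∨ c₁₄ ≠ 0 ∨ c₂₃ ≠ 0 ∨ c₂₄ ≠ 0
  · obtain ⟨e, he⟩ : ∃ e, n = p ^ e := by
      rcases h with h | h | h | h
      exacts [h₁₃.exists_eq_pow h, h₁₄.exists_eq_pow h, h₂₃.exists_eq_pow h, h₂₄.exists_eq_pow h]
    have he' : (n : ℤ) = (p : ℤ) ^ e := by exact_mod_cast he
    by_cases hdet : c₁₃ * c₂₄ - c₁₄ * c₂₃ = 0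
    · obtain ⟨x₁, x₂, y₁, y₂, hx, hy, rfl, rfl, rfl, rfl⟩ := exists_rank_one hdet h
      obtain ⟨w₂, w₁, hw⟩ := exists_mul_add_mul_eq_one hx
      obtain ⟨z₁, z₂, hz⟩ := exists_mul_add_mul_eq_one hy
      -- Rank one: the block is xyᵀ. The left matrix has first column x; the right one has columns
      -- (-y₂, y₁), killed by yᵀ, and z with yᵀz = 1. Only the corner entry a₁₄ remains.
      refine Classified.of_two_blocks .XXIV 0 1 0 0 x₁ (-w₁) x₂ w₂ (-y₂) z₁ y₁ z₂
        ⟨e, n, by omega, he'.le, isPair_mono (fun t => ?_) he' rfl⟩ ⟨?_, ?_⟩ ⟨?_, ?_, ?_, ?_⟩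
      · simp [mono, ← he]
      · rw [show x₁ * w₂ - -w₁ * x₂ = 1 by linear_combination hw]
        exact one_ne_zero
      · rw [show -y₂ * z₂ - z₁ * y₁ = -1 by linear_combination -hz]
        simp
      · ring
      · linear_combination x₁ * hz
      · ring
      · linear_combination x₂ * hz
    -- Rank two: the left matrix is the block with its columns swapped, which turns the block into
    -- the antidiagonal matrix.
    · refine Classified.of_two_blocks .XV 0 1 1 0 c₁₄ c₁₃ c₂₄ c₂₃ 1 0 0 1
        ⟨e, e, le_rfl, isPair_mono (fun t => ?_) he' he'⟩ ⟨?_, by simp⟩ (by simp)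
      · simp [mono, ← he]
      · intro h'
        exact hdet (by linear_combination -h')
  · simp only [not_or, not_not] at h
    obtain ⟨rfl, rfl, rfl, rfl⟩ := h
    exact classified_of_c₁₄_c₂₃ le_rfl h₁₄ h₂₃

/-- The case `d₂ = 0`, `d₁ = 2 * m`. -/
theorem classified_of_d₂_eq_zero [IsAlgClosed k] (hm : 0 < m)
    (h₁₂ : MonoAdditive c₁₂ m) (h₁₃ : MonoAdditive c₁₃ m) (h₂₄ : MonoAdditive c₂₄ m)
    (h₃₄ : MonoAdditive c₃₄ m)
    (h₁₄ : ∀ s t : k, c₁₄ * (s + t) ^ (2 * m) = c₁₄ * t ^ (2 * m) + c₁₂ * s ^ m * (c₂₄ * t ^ m) +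
      c₁₃ * s ^ m * (c₃₄ * t ^ m) + c₁₄ * s ^ (2 * m)) :
    Classified p (mono m m (2 * m) 0 c₁₂ c₁₃ c₁₄ 0 c₂₄ c₃₄)
      (omegaStar ((2 * m : ℕ) : ℤ) ((0 : ℕ) : ℤ)) := by
  -- Both cross terms are multiples of s^m t^m, so they cancel when the row v = (c₁₂, c₁₃) pairs to
  -- zero with the column w = (c₂₄, c₃₄).
  have hadd : c₁₂ * c₂₄ + c₁₃ * c₃₄ = 0 → MonoAdditive c₁₄ (2 * m) := fun h s t => by
    rw [h₁₄]
    linear_combination s ^ m * t ^ m * h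
  by_cases h : (c₁₂ ≠ 0 ∨ c₁₃ ≠ 0) ∨ (c₂₄ ≠ 0 ∨ c₃₄ ≠ 0)
  swap
  · simp only [not_or, not_not] at h
    obtain ⟨⟨rfl, rfl⟩, rfl, rfl⟩ := h
    exact classified_of_c₁₄_c₂₃ (by omega) (hadd (by simp)) (fun s t => by simp)
  obtain ⟨e, he⟩ : ∃ e, m = p ^ e := by
    rcases h with (h | h) | h | h
    exacts [h₁₂.exists_eq_pow h, h₁₃.exists_eq_pow h, h₂₄.exists_eq_pow h, h₃₄.exists_eq_pow h]
  have he' : (m : ℤ) = (p : ℤ) ^ e := by exact_mod_cast he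
  -- At s = t = 1, Frobenius turns (1 + 1)^{2m} into 4, so 4c₁₄ = 2c₁₄ + v·w.
  have hdot : 2 * c₁₄ = c₁₂ * c₂₄ + c₁₃ * c₃₄ := by
    have := h₁₄ 1 1
    rw [he, pow_mul', add_pow_char_pow] at this
    simp only [one_pow] at this
    linear_combination this
  have hlarge : MonoAdditive c₁₄ (2 * m) → c₁₄ ≠ 0 →
      ∃ f, e + 1 ≤ f ∧ 2 * m = p ^ f ∧ ((2 * m : ℕ) : ℤ) = (p : ℤ) ^ f := fun h hc => by
    obtain ⟨f, hf⟩ := h.exists_eq_pow (p := p) hc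
    exact ⟨f, lt_of_prime_pow_lt p (by omega), hf, by exact_mod_cast hf⟩
  by_cases hv : c₁₂ ≠ 0 ∨ c₁₃ ≠ 0
  · obtain ⟨g₁, g₂, hg⟩ := exists_mul_add_mul_eq_one hv
    by_cases hw : c₂₄ ≠ 0 ∨ c₃₄ ≠ 0
    · by_cases hvw : c₁₂ * c₂₄ + c₁₃ * c₃₄ = 0
      -- In the plane, the vectors pairing to zero with v form the line spanned by (-c₁₃, c₁₂).
      · obtain ⟨a, ha, rfl, rfl⟩ : ∃ a, a ≠ 0 ∧ c₂₄ = a * -c₁₃ ∧ c₃₄ = a * c₁₂ := by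
          have e₁ : c₂₄ = (g₁ * c₃₄ - g₂ * c₂₄) * -c₁₃ := by
            linear_combination g₁ * hvw - c₂₄ * hg
          have e₂ : c₃₄ = (g₁ * c₃₄ - g₂ * c₂₄) * c₁₂ := by
            linear_combination g₂ * hvw - c₃₄ * hg
          refine ⟨_, fun h0 => ?_, e₁, e₂⟩
          rw [h0, zero_mul] at e₁ e₂
          simp [e₁, e₂] at hw
        by_cases hc : c₁₄ = 0
        · subst hc
          -- The middle block has columns g, with v·g = 1, and (-c₁₃, c₁₂) = w/a, with v·w = 0.
          refine Classified.of_middle_block .VI 1 0 0 0 1 1 (a⁻¹) g₁ (-c₁₃) g₂ c₁₂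
            ⟨e, 0, le_rfl, isPair_mono (fun t => ?_) (by push_cast; rw [he']; ring) rfl⟩
            ⟨one_ne_zero, inv_ne_zero ha, ?_⟩ ⟨?_, ?_, ?_, ?_, ?_⟩
          · simp [mono, ← he]
          · rw [show g₁ * c₁₂ - -c₁₃ * g₂ = 1 by linear_combination hg]
            exact one_ne_zero
          · linear_combination hg
          · ring
          · ring
          · field_simp; ring
          · field_simp; ring
        · have h2 : (2 : k) = 0 := by
            rw [hvw] at hdot
            exact (mul_eq_zero.1 hdot).resolve_right hc
          obtain rfl := eq_of_natCast_eq_zero p Nat.prime_two h2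
          -- Now w/c₁₄ is the first column and g the second; x₄ = 1/c₁₄ normalises the corner.
          refine Classified.of_middle_block .XXI 0 1 1 1 0 1 (c₁₄⁻¹) (a * c₁₄⁻¹ * -c₁₃) g₁
            (a * c₁₄⁻¹ * c₁₂) g₂
            ⟨rfl, e, isPair_mono (fun t => ?_) (by push_cast; rw [he']; ring) rfl⟩
            ⟨one_ne_zero, inv_ne_zero hc, ?_⟩ ⟨?_, ?_, ?_, ?_, ?_⟩
          · simp [mono, ← he, pow_succ, mul_comm]
          · rw [show a * c₁₄⁻¹ * -c₁₃ * g₂ - g₁ * (a * c₁₄⁻¹ * c₁₂) = -(a * c₁₄⁻¹) by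
              linear_combination -(a * c₁₄⁻¹) * hg]
            exact neg_ne_zero.2 (mul_ne_zero ha (inv_ne_zero hc))
          · ring
          · linear_combination hg
          · field_simp
          · ring
          · ring
      · have h2 : (2 : k) ≠ 0 := fun h0 => hvw (by rw [← hdot, h0, zero_mul])
        set b := c₁₂ * c₂₄ + c₁₃ * c₃₄ with hb
        -- With b = v·w nonzero, w is transverse to the kernel of v: the columns are w/b and the
        -- kernel vector (-c₁₃, c₁₂).
        refine Classified.of_middle_block .IX 1 0 (1 / 2) 1 0 1 (b⁻¹) (c₂₄ * b⁻¹) (-c₁₃)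
          (c₃₄ * b⁻¹) c₁₂
          ⟨three_le_of_two_ne_zero p h2, e, isPair_mono (fun t => ?_)
            (by push_cast; rw [he']) rfl⟩
          ⟨one_ne_zero, inv_ne_zero hvw, ?_⟩ ⟨?_, ?_, ?_, ?_, ?_⟩
        · simp [mono, ← he]
        · rw [show c₂₄ * b⁻¹ * c₁₂ - -c₁₃ * (c₃₄ * b⁻¹) = b * b⁻¹ by rw [hb]; ring]
          exact mul_ne_zero hvw (inv_ne_zero hvw)
        · rw [show c₁₂ * (c₂₄ * b⁻¹) + c₁₃ * (c₃₄ * b⁻¹) = b * b⁻¹ by rw [hb]; ring]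
          simp [hvw]
        · ring
        · field_simp
          linear_combination hdot
        · ring
        · ring
    · simp only [not_or, not_not] at hw
      obtain ⟨rfl, rfl⟩ := hw
      have hdet : g₁ * c₁₂ - -c₁₃ * g₂ ≠ 0 := by
        rw [show g₁ * c₁₂ - -c₁₃ * g₂ = 1 by linear_combination hg]
        exact one_ne_zero
      by_cases hc : c₁₄ = 0
      · subst hc
        refine Classified.of_middle_block .XII 1 0 0 0 0 1 1 g₁ (-c₁₃) g₂ c₁₂
          ⟨e, 0, le_rfl, isPair_mono (fun t => ?_) (by push_cast; rw [he']; ring) rfl⟩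
          ⟨one_ne_zero, one_ne_zero, hdet⟩
          ⟨by linear_combination hg, by ring, by ring, by ring, by ring⟩
        simp [mono, ← he]
      · obtain ⟨f, hef, hf, hf'⟩ := hlarge (hadd (by simp)) hc
        refine Classified.of_middle_block .XI 1 0 1 0 0 1 (c₁₄⁻¹) g₁ (-c₁₃) g₂ c₁₂
          ⟨e, f, hef, isPair_mono (fun t => ?_) hf' (by rw [← hf', ← he']; push_cast; ring)⟩
          ⟨one_ne_zero, inv_ne_zero hc, hdet⟩
          ⟨by linear_combination hg, by ring, by field_simp, by ring, by ring⟩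
        simp [mono, ← he, ← hf]
  · have hw := h.resolve_left hv
    simp only [not_or, not_not] at hv
    obtain ⟨rfl, rfl⟩ := hv
    obtain ⟨g₁, g₂, hg⟩ := exists_mul_add_mul_eq_one hw
    have hdet : g₂ * c₃₄ - c₂₄ * -g₁ ≠ 0 := by
      rw [show g₂ * c₃₄ - c₂₄ * -g₁ = 1 by linear_combination hg]
      exact one_ne_zero
    by_cases hc : c₁₄ = 0
    · subst hc
      refine Classified.of_middle_block .XX 0 0 0 0 1 1 1 g₂ c₂₄ (-g₁) c₃₄
        ⟨e, 0, le_rfl, isPair_mono (fun t => ?_) (by push_cast; rw [he']; ring) rfl⟩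
        ⟨one_ne_zero, one_ne_zero, hdet⟩ ⟨by ring, by ring, by ring, by ring, by ring⟩
      simp [mono, ← he]
    · obtain ⟨f, hef, hf, hf'⟩ := hlarge (hadd (by simp)) hc
      refine Classified.of_middle_block .XIX 0 0 1 0 1 c₁₄ 1 g₂ c₂₄ (-g₁) c₃₄
        ⟨e, f, hef, isPair_mono (fun t => ?_) hf' (by rw [← hf', ← he']; push_cast; ring)⟩
        ⟨hc, one_ne_zero, hdet⟩ ⟨by ring, by ring, by ring, by ring, by ring⟩
      simp [mono, ← he, ← hf]

end Classification



/-! ### Even d₁ - d₂: support patterns and normal forms -/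

section Generic

variable {k : Type*} [Field k] [IsAlgClosed k] {p : ℕ} [Fact p.Prime] [CharP k p]
  {m r l n : ℕ} {c₁₂ c₁₃ c₁₄ c₂₃ c₂₄ c₃₄ : k}

/-- The case in which `d₁ - d₂ = 2 * d₂` and the superdiagonal has two adjacent nonzero entries. -/
theorem classified_of_adjacent {e : ℕ} (hm : m = p ^ e)
    (h : (c₁₂ ≠ 0 ∨ c₃₄ ≠ 0) ∧ c₂₃ ≠ 0)
    (h₁₃ : ∀ s t : k, c₁₃ * (s + t) ^ (2 * m) =
      c₁₃ * t ^ (2 * m) + c₁₂ * s ^ m * (c₂₃ * t ^ m) + c₁₃ * s ^ (2 * m))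
    (h₂₄ : ∀ s t : k, c₂₄ * (s + t) ^ (2 * m) =
      c₂₄ * t ^ (2 * m) + c₂₃ * s ^ m * (c₃₄ * t ^ m) + c₂₄ * s ^ (2 * m))
    (h₁₄ : ∀ s t : k, c₁₄ * (s + t) ^ (3 * m) = c₁₄ * t ^ (3 * m) +
      c₁₂ * s ^ m * (c₂₄ * t ^ (2 * m)) + c₁₃ * s ^ (2 * m) * (c₃₄ * t ^ m) +
      c₁₄ * s ^ (3 * m)) :
    Classified p (mono m (2 * m) (3 * m) m c₁₂ c₁₃ c₁₄ c₂₃ c₂₄ c₃₄)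
      (omegaStar ((3 * m : ℕ) : ℤ) (m : ℤ)) := by
  have hm0 : m ≠ 0 := hm ▸ (pow_pos (Fact.out : p.Prime).pos e).ne'
  have hm' : (m : ℤ) = (p : ℤ) ^ e := by exact_mod_cast hm
  have hl : ((3 * m : ℕ) : ℤ) = 3 * (p : ℤ) ^ e := by push_cast; rw [hm']
  have e₁₃ : 2 * c₁₃ = c₁₂ * c₂₃ := by
    have := h₁₃ 1 1
    rw [hm, pow_mul', add_pow_char_pow] at this
    simp only [one_pow] at this
    linear_combination this
  have e₂₄ : 2 * c₂₄ = c₂₃ * c₃₄ := by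
    have := h₂₄ 1 1
    rw [hm, pow_mul', add_pow_char_pow] at this
    simp only [one_pow] at this
    linear_combination this
  -- With t = 1, Frobenius expands (x + 1)^{3m} as (x^m + 1)³; the two equations are the
  -- coefficients of x^m and x^{2m}.
  obtain ⟨e₁₄, e₁₄'⟩ : 3 * c₁₄ - c₁₂ * c₂₄ = 0 ∧ 3 * c₁₄ - c₁₃ * c₃₄ = 0 := by
    refine eq_zero_of_forall_add_pow_eq_zero (a := m) (b := 2 * m) (by omega) fun x => ?_
    have := h₁₄ x 1
    simp only [pow_mul', one_pow] at this ⊢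
    rw [hm, add_pow_char_pow, one_pow, ← hm] at this
    linear_combination this
  obtain ⟨h, hc₂₃⟩ := h
  -- In characteristic 2 both products c₁₂c₂₃ and c₂₃c₃₄ would vanish, against the hypothesis on the
  -- superdiagonal.
  have h2 : (2 : k) ≠ 0 := by
    intro h0
    rw [h0, zero_mul, zero_eq_mul] at e₁₃ e₂₄
    tauto
  by_cases hc₃₄ : c₃₄ = 0
  · subst hc₃₄
    have hc₁₂ : c₁₂ ≠ 0 := by simpa using h
    obtain rfl : c₂₄ = 0 := by simpa [h2] using e₂₄
    by_cases hc₁₄ : c₁₄ = 0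
    · subst hc₁₄
      refine Classified.of_diagonal .III 1 (1 / 2) 0 1 0 0 (c₁₂ * c₂₃) c₂₃ 1 1
        ⟨three_le_of_two_ne_zero p h2, e, isPair_mono (fun t => ?_) hl hm'⟩
        (by simp [*]) ⟨by ring, ?_, by ring, by ring, by ring, by ring⟩
      · simp [mono, ← hm]
      · field_simp
        linear_combination e₁₃
    · have h3 : (3 : k) = 0 := by simpa [hc₁₄] using e₁₄
      obtain rfl := eq_of_natCast_eq_zero p Nat.prime_three h3
      refine Classified.of_diagonal .II 1 (1 / 2) 1 1 0 0 (c₁₂ * c₂₃) c₂₃ 1 (c₁₂ * c₂₃ / c₁₄)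
        ⟨rfl, e, isPair_mono (fun t => ?_) (by rw [hl]; push_cast; ring) hm'⟩
        (by simp [*]) ⟨by ring, ?_, by field_simp, by ring, by ring, by ring⟩
      · simp [mono, ← hm, pow_succ, mul_comm]
      · field_simp
        linear_combination e₁₃
  · by_cases hc₁₂ : c₁₂ = 0
    · subst hc₁₂
      obtain rfl : c₁₃ = 0 := by simpa [h2] using e₁₃
      by_cases hc₁₄ : c₁₄ = 0
      · subst hc₁₄
        refine Classified.of_diagonal .VIII 0 0 0 1 (1 / 2) 1 1 (c₂₃ * c₃₄) c₃₄ 1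
          ⟨three_le_of_two_ne_zero p h2, e, isPair_mono (fun t => ?_) hl hm'⟩
          (by simp [*]) ⟨by ring, by ring, by ring, by ring, ?_, by ring⟩
        · simp [mono, ← hm]
        · field_simp
          linear_combination e₂₄
      · have h3 : (3 : k) = 0 := by simpa [hc₁₄] using e₁₄
        obtain rfl := eq_of_natCast_eq_zero p Nat.prime_three h3
        refine Classified.of_diagonal .VII 0 0 1 1 (1 / 2) 1 c₁₄ (c₂₃ * c₃₄) c₃₄ 1
          ⟨rfl, e, isPair_mono (fun t => ?_) (by rw [hl]; push_cast; ring) hm'⟩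
          (by simp [*]) ⟨by ring, by ring, by ring, by ring, ?_, by ring⟩
        · simp [mono, ← hm, pow_succ, mul_comm]
        · field_simp
          linear_combination e₂₄
    · have h6 : 6 * c₁₄ = c₁₂ * c₂₃ * c₃₄ := by
        linear_combination 2 * e₁₄ + c₁₂ * e₂₄
      have h3 : (3 : k) ≠ 0 := fun h0 => by
        have h0' : c₁₂ * c₂₃ * c₃₄ = 0 := by linear_combination -h6 + 2 * c₁₄ * h0
        simp [hc₁₂, hc₂₃, hc₃₄] at h0'
      have h6' : (6 : k) ≠ 0 := by
        rw [show (6 : k) = 2 * 3 by norm_num]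
        exact mul_ne_zero h2 h3
      -- Products of superdiagonal constants from the right make the superdiagonal 1; the relations
      -- then fix the other entries.
      refine Classified.of_diagonal .I 1 (1 / 2) (1 / 6) 1 (1 / 2) 1 (c₁₂ * c₂₃ * c₃₄)
        (c₂₃ * c₃₄) c₃₄ 1
        ⟨five_le_of_three_ne_zero p h2 h3, e, isPair_mono (fun t => ?_) hl hm'⟩
        (by simp [*]) ⟨by ring, ?_, ?_, by ring, ?_, by ring⟩
      · simp [mono, ← hm]
      · field_simp
        linear_combination e₁₃
      · field_simp
        linear_combination h6
      · field_simp
        linear_combination e₂₄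

/-- The case `a₂₃ ≠ 0`, `a₁₂ = a₃₄ = 0`. -/
theorem classified_of_c₂₃_ne_zero (hm : 0 < m) (hn : 0 < n) (hc₂₃ : c₂₃ ≠ 0)
    (h₂₃ : MonoAdditive c₂₃ n) (h₁₃ : MonoAdditive c₁₃ (m + n)) (h₂₄ : MonoAdditive c₂₄ (m + n))
    (h₁₄ : MonoAdditive c₁₄ (2 * m + n)) :
    Classified p (mono m (m + n) (2 * m + n) n 0 c₁₃ c₁₄ c₂₃ c₂₄ 0)
      (omegaStar ((2 * m + n : ℕ) : ℤ) (n : ℤ)) := by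
  by_cases h : c₁₃ ≠ 0 ∨ c₂₄ ≠ 0
  swap
  · simp only [not_or, not_not] at h
    obtain ⟨rfl, rfl⟩ := h
    exact classified_of_c₁₄_c₂₃ (by omega) h₁₄ h₂₃
  obtain ⟨e, he⟩ := h₂₃.exists_eq_pow (p := p) hc₂₃
  obtain ⟨f, hf⟩ : ∃ f, m + n = p ^ f := by
    rcases h with h | h
    exacts [h₁₃.exists_eq_pow h, h₂₄.exists_eq_pow h]
  have hef : e < f := lt_of_prime_pow_lt p (by omega)
  have he' : (n : ℤ) = (p : ℤ) ^ e := by exact_mod_cast he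
  have hf' : (m : ℤ) + n = (p : ℤ) ^ f := by exact_mod_cast hf
  have hl : ((2 * m + n : ℕ) : ℤ) = 2 * (p : ℤ) ^ f - (p : ℤ) ^ e := by
    push_cast
    linear_combination 2 * hf' - he'
  -- Here m + n = p^f, and 2m + n lies strictly between p^f and 2p^f, so it is not a power of p.
  obtain rfl : c₁₄ = 0 := by
    by_contra hc
    obtain ⟨g, hg⟩ := h₁₄.exists_eq_pow (p := p) hc
    have := two_mul_le_of_prime_pow_lt p (a := f) (b := g) (by omega)
    omega
  by_cases hc₁₃ : c₁₃ = 0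
  · subst hc₁₃
    have hc₂₄ : c₂₄ ≠ 0 := by simpa using h
    refine Classified.of_diagonal .XVI 0 0 0 1 1 0 1 1 (c₂₃⁻¹) (c₂₄⁻¹)
      ⟨e, f, hef, isPair_mono (fun t => ?_) hl he'⟩ (by simp [*]) (by simp [*])
    simp [mono, ← he, ← hf]
  · by_cases hc₂₄ : c₂₄ = 0
    · subst hc₂₄
      refine Classified.of_diagonal .XIV 0 1 0 1 0 0 c₁₃ c₂₃ 1 1
        ⟨f, e, hef, isPair_mono (fun t => ?_) hl he'⟩ (by simp [*]) (by simp [*])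
      simp [mono, ← he, ← hf]
    · refine Classified.of_diagonal .XIII 0 1 0 1 1 0 c₁₃ c₂₃ 1 (c₂₃ / c₂₄)
        ⟨f, e, hef, isPair_mono (fun t => ?_) hl he'⟩ (by simp [*])
        ⟨by ring, by ring, by ring, by ring, by field_simp, by ring⟩
      simp [mono, ← he, ← hf]

/-- The case `a₂₃ = 0`, `0 < d₂ < d₁`. -/
theorem classified_of_c₂₃_eq_zero (hm : 0 < m) (hn : 0 < n)
    (h₁₂ : MonoAdditive c₁₂ m) (h₃₄ : MonoAdditive c₃₄ m)
    (h₁₃ : MonoAdditive c₁₃ (m + n)) (h₂₄ : MonoAdditive c₂₄ (m + n))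
    (h₁₄ : ∀ s t : k, c₁₄ * (s + t) ^ (2 * m + n) = c₁₄ * t ^ (2 * m + n) +
      c₁₂ * s ^ m * (c₂₄ * t ^ (m + n)) + c₁₃ * s ^ (m + n) * (c₃₄ * t ^ m) +
      c₁₄ * s ^ (2 * m + n)) :
    Classified p (mono m (m + n) (2 * m + n) n c₁₂ c₁₃ c₁₄ 0 c₂₄ c₃₄)
      (omegaStar ((2 * m + n : ℕ) : ℤ) (n : ℤ)) := by
  -- Exchanging s and t swaps the monomials of the two cross terms, so their coefficients agree.
  have hsymm : c₁₂ * c₂₄ = c₁₃ * c₃₄ := by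
    refine sub_eq_zero.1 (eq_zero_of_forall_add_pow_eq_zero (a := m) (b := m + n) (by omega)
      (B := -(c₁₂ * c₂₄ - c₁₃ * c₃₄)) fun x => ?_).1
    have e₁ := h₁₄ x 1
    have e₂ := h₁₄ 1 x
    rw [add_comm] at e₂
    simp only [one_pow] at e₁ e₂
    linear_combination e₂ - e₁
  by_cases hne : c₁₂ * c₂₄ ≠ 0
  · obtain ⟨hc₁₂, hc₂₄⟩ := mul_ne_zero_iff.1 hne
    obtain ⟨hc₁₃, hc₃₄⟩ := mul_ne_zero_iff.1 (hsymm ▸ hne)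
    obtain ⟨e, he⟩ := h₁₂.exists_eq_pow (p := p) hc₁₂
    obtain ⟨f, hf⟩ := h₁₃.exists_eq_pow (p := p) hc₁₃
    have he' : (m : ℤ) = (p : ℤ) ^ e := by exact_mod_cast he
    have hf' : (m : ℤ) + n = (p : ℤ) ^ f := by exact_mod_cast hf
    have hl : 2 * m + n = p ^ e + p ^ f := by omega
    -- Since 2m + n = p^e + p^f, (s + t)^{2m+n} has exactly the two cross terms s^m t^{m+n} and
    -- s^{m+n} t^m, each with coefficient 1.
    obtain rfl : c₁₄ = c₁₂ * c₂₄ := by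
      refine sub_eq_zero.1 (eq_zero_of_forall_add_pow_eq_zero (a := m) (b := m + n) (by omega)
        (B := c₁₄ - c₁₂ * c₂₄) fun x => ?_).1
      have := h₁₄ x 1
      rw [hl, pow_add (x + 1), pow_add x, add_pow_char_pow, add_pow_char_pow, ← he, ← hf] at this
      simp only [one_pow] at this
      linear_combination this - x ^ (m + n) * hsymm
    refine Classified.of_diagonal .IV 1 1 1 0 1 1 (c₁₂ * c₂₄) c₂₄ c₃₄ 1
      ⟨e, f, lt_of_prime_pow_lt p (by omega), isPair_mono (fun t => ?_)
        (by push_cast; linear_combination he' + hf') (by linear_combination hf' - he')⟩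
      (by simp [*]) ⟨by ring, by linear_combination -hsymm, by ring, by ring, by ring, by ring⟩
    simp [mono, ← he, ← hf, show 2 * m + n = m + (m + n) by ring]
  rw [not_not] at hne
  have hne' : c₁₃ * c₃₄ = 0 := hsymm ▸ hne
  have h₁₄' : MonoAdditive c₁₄ (2 * m + n) := fun s t => by
    rw [h₁₄]
    linear_combination s ^ m * t ^ (m + n) * hne + s ^ (m + n) * t ^ m * hne'
  -- With the cross terms gone a₁₄ is additive, and the gap p^f < 2m + n < 2p^f excludes it.
  have hexcl : c₁₃ ≠ 0 ∨ c₂₄ ≠ 0 → c₁₄ = 0 ∧ ∃ f, m + n = p ^ f := by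
    intro h
    obtain ⟨f, hf⟩ : ∃ f, m + n = p ^ f := by
      rcases h with h | h
      exacts [h₁₃.exists_eq_pow h, h₂₄.exists_eq_pow h]
    refine ⟨?_, f, hf⟩
    by_contra hc
    obtain ⟨g, hg⟩ := h₁₄'.exists_eq_pow (p := p) hc
    have := two_mul_le_of_prime_pow_lt p (a := f) (b := g) (by omega)
    omega
  by_cases h : c₁₂ = 0 ∧ c₃₄ = 0
  · obtain ⟨rfl, rfl⟩ := h
    by_cases h : c₁₃ ≠ 0 ∨ c₂₄ ≠ 0
    · obtain ⟨rfl, f, hf⟩ := hexcl h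
      have hf' : (m : ℤ) + n = (p : ℤ) ^ f := by exact_mod_cast hf
      by_cases hc₁₃ : c₁₃ = 0
      · subst hc₁₃
        have hc₂₄ : c₂₄ ≠ 0 := by simpa using h
        refine Classified.of_diagonal .XXV 0 0 0 0 1 0 1 c₂₄ 1 1
          ⟨f, _, ?_, ?_, isPair_mono (fun t => ?_) rfl
            (by push_cast; linear_combination 2 * hf')⟩ (by simp [*]) (by simp)
        · push_cast; omega
        · push_cast; omega
        · simp [mono, ← hf]
      · by_cases hc₂₄ : c₂₄ = 0
        · subst hc₂₄
          refine Classified.of_diagonal .XXIII 0 1 0 0 0 0 c₁₃ 1 1 1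
            ⟨f, _, ?_, ?_, isPair_mono (fun t => ?_) rfl
              (by push_cast; linear_combination 2 * hf')⟩ (by simp [*]) (by simp)
          · push_cast; omega
          · push_cast; omega
          · simp [mono, ← hf]
        · refine Classified.of_diagonal .XXII 0 1 0 0 1 0 c₁₃ c₂₄ 1 1
            ⟨f, _, ?_, ?_, isPair_mono (fun t => ?_) rfl
              (by push_cast; linear_combination 2 * hf')⟩ (by simp [*]) (by simp)
          · push_cast; omega
          · push_cast; omega
          · simp [mono, ← hf]
    · simp only [not_or, not_not] at h
      obtain ⟨rfl, rfl⟩ := h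
      exact classified_of_c₁₄_c₂₃ (by omega) h₁₄' (fun s t => by simp)
  obtain ⟨e, he⟩ : ∃ e, m = p ^ e := by
    by_cases hc : c₁₂ = 0
    · exact h₃₄.exists_eq_pow fun h' => h ⟨hc, h'⟩
    · exact h₁₂.exists_eq_pow hc
  have he' : (m : ℤ) = (p : ℤ) ^ e := by exact_mod_cast he
  by_cases hx : c₁₃ ≠ 0 ∨ c₂₄ ≠ 0
  · obtain ⟨rfl, f, hf⟩ := hexcl hx
    have hf' : (m : ℤ) + n = (p : ℤ) ^ f := by exact_mod_cast hf
    have hef : e < f := lt_of_prime_pow_lt p (by omega)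
    have hl : ((2 * m + n : ℕ) : ℤ) = (p : ℤ) ^ e + (p : ℤ) ^ f := by
      push_cast
      linear_combination he' + hf'
    have hd : (n : ℤ) = (p : ℤ) ^ f - (p : ℤ) ^ e := by linear_combination hf' - he'
    by_cases hc₁₂ : c₁₂ = 0
    · subst hc₁₂
      have hc₃₄ : c₃₄ ≠ 0 := by simpa using h
      obtain rfl : c₁₃ = 0 := by simpa [hc₃₄] using hne'
      have hc₂₄ : c₂₄ ≠ 0 := by simpa using hx
      refine Classified.of_diagonal .XVIII 0 0 0 0 1 1 1 c₂₄ c₃₄ 1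
        ⟨e, f, hef, isPair_mono (fun t => ?_) hl hd⟩ (by simp [*]) (by simp)
      simp [mono, ← he, ← hf]
    · obtain rfl : c₂₄ = 0 := by simpa [hc₁₂] using hne
      have hc₁₃ : c₁₃ ≠ 0 := by simpa using hx
      obtain rfl : c₃₄ = 0 := by simpa [hc₁₃] using hne'
      refine Classified.of_diagonal .X 1 1 0 0 0 0 1 (c₁₂⁻¹) (c₁₃⁻¹) 1
        ⟨e, f, hef, isPair_mono (fun t => ?_) hl hd⟩ (by simp [*]) (by simp [*])
      simp [mono, ← he, ← hf]
  simp only [not_or, not_not] at hx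
  obtain ⟨rfl, rfl⟩ := hx
  by_cases hc₁₄ : c₁₄ = 0
  · subst hc₁₄
    have hl : ((2 * m + n : ℕ) : ℤ) = 2 * (p : ℤ) ^ e + n := by push_cast; rw [he']
    by_cases hc₁₂ : c₁₂ = 0
    · subst hc₁₂
      have hc₃₄ : c₃₄ ≠ 0 := by simpa using h
      refine Classified.of_diagonal .XX 0 0 0 0 0 1 1 1 c₃₄ 1
        ⟨e, n, by omega, isPair_mono (fun t => ?_) hl rfl⟩ (by simp [*]) (by simp)
      simp [mono, ← he]
    · by_cases hc₃₄ : c₃₄ = 0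
      · subst hc₃₄
        refine Classified.of_diagonal .XII 1 0 0 0 0 0 c₁₂ 1 1 1
          ⟨e, n, by omega, isPair_mono (fun t => ?_) hl rfl⟩ (by simp [*]) (by simp)
        simp [mono, ← he]
      · refine Classified.of_diagonal .VI 1 0 0 0 0 1 c₁₂ 1 c₃₄ 1
          ⟨e, n, by omega, isPair_mono (fun t => ?_) (hl.trans (add_comm _ _)) rfl⟩
          (by simp [*]) (by simp)
        simp [mono, ← he]
  · obtain ⟨f, hf⟩ := h₁₄'.exists_eq_pow (p := p) hc₁₄
    have hef : e + 1 ≤ f := lt_of_prime_pow_lt p (by omega)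
    have hf' : ((2 * m + n : ℕ) : ℤ) = (p : ℤ) ^ f := by exact_mod_cast hf
    have hd : (n : ℤ) = (p : ℤ) ^ f - 2 * (p : ℤ) ^ e := by
      rw [← hf', ← he']
      push_cast
      ring
    by_cases hc₁₂ : c₁₂ = 0
    · subst hc₁₂
      have hc₃₄ : c₃₄ ≠ 0 := by simpa using h
      refine Classified.of_diagonal .XIX 0 0 1 0 0 1 c₁₄ 1 c₃₄ 1
        ⟨e, f, hef, isPair_mono (fun t => ?_) hf' hd⟩ (by simp [*]) (by simp)
      simp [mono, ← he, ← hf]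
    · by_cases hc₃₄ : c₃₄ = 0
      · subst hc₃₄
        refine Classified.of_diagonal .XI 1 0 1 0 0 0 1 (c₁₂⁻¹) 1 (c₁₄⁻¹)
          ⟨e, f, hef, isPair_mono (fun t => ?_) hf' hd⟩ (by simp [*]) (by simp [*])
        simp [mono, ← he, ← hf]
      · refine Classified.of_diagonal .V 1 0 1 0 0 1 c₁₄ (c₁₄ / c₁₂) c₃₄ 1
          ⟨e, f, hef, isPair_mono (fun t => ?_) hf' hd⟩ (by simp [*])
          ⟨by field_simp, by ring, by ring, by ring, by ring, by ring⟩
        simp [mono, ← he, ← hf]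

/-- The classification when `d₁ - d₂ = 2 * m` is even and `d₂ = n`. -/
theorem classified_of_uniAdditive
    (h : UniAdditive (fun t : k => c₁₂ * t ^ m) (fun t => c₁₃ * t ^ (m + n))
      (fun t => c₁₄ * t ^ (2 * m + n)) (fun t => c₂₃ * t ^ n) (fun t => c₂₄ * t ^ (m + n))
      (fun t => c₃₄ * t ^ m)) :
    Classified p (mono m (m + n) (2 * m + n) n c₁₂ c₁₃ c₁₄ c₂₃ c₂₄ c₃₄)
      (omegaStar ((2 * m + n : ℕ) : ℤ) (n : ℤ)) := by
  have h₁₂ : MonoAdditive c₁₂ m := fun s t => ((h s t).1).trans (add_comm _ _)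
  have h₁₃ := fun s t => (h s t).2.1
  have h₁₄ := fun s t => (h s t).2.2.1
  have h₂₃ : MonoAdditive c₂₃ n := fun s t => ((h s t).2.2.2.1).trans (add_comm _ _)
  have h₂₄ := fun s t => (h s t).2.2.2.2.1
  have h₃₄ : MonoAdditive c₃₄ m := fun s t => ((h s t).2.2.2.2.2).trans (add_comm _ _)
  clear h
  beta_reduce at h₁₃ h₁₄ h₂₄
  rcases Nat.eq_zero_or_pos m with rfl | hm
  -- Exponent 0 gives a constant function, and an additive constant is zero.
  · obtain rfl : c₁₂ = 0 := by simpa using h₁₂ 0 0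
    obtain rfl : c₃₄ = 0 := by simpa using h₃₄ 0 0
    simp only [zero_add, mul_zero, zero_mul, add_zero] at *
    exact classified_of_d₁_eq_d₂ (fun s t => (h₁₃ s t).trans (add_comm _ _))
      (fun s t => (h₁₄ s t).trans (add_comm _ _)) h₂₃
      (fun s t => (h₂₄ s t).trans (add_comm _ _))
  rcases Nat.eq_zero_or_pos n with rfl | hn
  · obtain rfl : c₂₃ = 0 := by simpa using h₂₃ 0 0
    simp only [mul_zero, zero_mul, add_zero] at *
    exact classified_of_d₂_eq_zero hm h₁₂ (fun s t => (h₁₃ s t).trans (add_comm _ _))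
      (fun s t => (h₂₄ s t).trans (add_comm _ _)) h₃₄ h₁₄
  by_cases hc₂₃ : c₂₃ = 0
  · subst hc₂₃
    simp only [mul_zero, zero_mul, add_zero] at *
    exact classified_of_c₂₃_eq_zero hm hn h₁₂ h₃₄ (fun s t => (h₁₃ s t).trans (add_comm _ _))
      (fun s t => (h₂₄ s t).trans (add_comm _ _)) h₁₄
  by_cases hc : c₁₂ = 0 ∧ c₃₄ = 0
  · obtain ⟨rfl, rfl⟩ := hc
    simp only [mul_zero, zero_mul, add_zero] at *
    exact classified_of_c₂₃_ne_zero hm hn hc₂₃ h₂₃ (fun s t => (h₁₃ s t).trans (add_comm _ _))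
      (fun s t => (h₂₄ s t).trans (add_comm _ _)) (fun s t => (h₁₄ s t).trans (add_comm _ _))
  have hc' : c₁₂ ≠ 0 ∨ c₃₄ ≠ 0 := by tauto
  obtain ⟨e, he⟩ : ∃ e, m = p ^ e := by
    rcases hc' with h | h
    exacts [h₁₂.exists_eq_pow h, h₃₄.exists_eq_pow h]
  -- If m ≠ n, symmetry in s and t kills a cross term in s^m t^n; then c₁₂c₂₃ = c₃₄c₂₃ = 0, although
  -- c₂₃ and one of c₁₂, c₃₄ are nonzero.
  obtain rfl : m = n := by
    by_contra hmn
    have key : ∀ {a b c : k}, (∀ s t : k, c * (s + t) ^ (m + n) =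
        c * t ^ (m + n) + a * s ^ m * (b * t ^ n) + c * s ^ (m + n)) → a * b = 0 := by
      intro a b c h
      refine (eq_zero_of_forall_add_pow_eq_zero hmn (B := -(a * b)) fun x => ?_).1
      have e₁ := h x 1
      have e₂ := h 1 x
      rw [add_comm] at e₂
      simp only [one_pow] at e₁ e₂
      linear_combination e₂ - e₁
    have k₁ := key h₁₃
    have k₂ : c₃₄ * c₂₃ = 0 := key (c := c₂₄) fun s t => by
      have := h₂₄ t s
      rw [add_comm] at this
      linear_combination this
    simp only [mul_eq_zero, hc₂₃, or_false] at k₁ k₂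
    exact hc ⟨k₁, k₂⟩
  rw [show 2 * m + m = 3 * m by ring, show m + m = 2 * m by ring] at *
  exact classified_of_adjacent he ⟨hc', hc₂₃⟩ h₁₃ h₂₄ h₁₄

end Generic



/-! ### From representations to monomial entries -/

section Representations

variable {k : Type*} [Field k]

theorem Homog.exists_eq_mul_pow {w : ℤ} {f : k → k} (h : Homog w f) {m : ℕ}
    (hw : w = 2 * (m : ℤ)) : ∃ c, ∀ t, f t = c * t ^ m := by
  obtain ⟨c, m', hf, rfl | h⟩ := h
  · exact ⟨0, by simpa using hf⟩
  · obtain rfl : m' = m := by omega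
    exact ⟨c, hf⟩

theorem Homog.eq_zero_of_odd {w : ℤ} {f : k → k} (h : Homog w f) (hw : Odd w) (t : k) :
    f t = 0 := by
  obtain ⟨c, m', hf, rfl | h⟩ := h
  · simpa using hf t
  · obtain ⟨r, hr⟩ := hw
    omega

theorem Homog.eq_apply_zero {w : ℤ} {f : k → k} (h : Homog w f) (hw : w ≤ 0) (t : k) :
    f t = f 0 := by
  obtain ⟨c, m', hf, rfl | h⟩ := h
  · simp [hf]
  · obtain rfl : m' = 0 := by omega
    simp [hf]

theorem homog_entry [Infinite k] {n : ℕ} {φ : Ga k → SLn k n} {ω : Gm k → SLn k n} {d : Fin n → ℤ}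
    (hφ : IsMorphism k φ)
    (hω : ∀ u : Gm k, (ω u).1 = Matrix.diagonal fun i => ((u ^ d i : kˣ) : k))
    (hconj : ∀ (u : Gm k) (t : k), φ (.ofAdd ((u : k) ^ 2 * t)) * ω u = ω u * φ (.ofAdd t))
    (i j : Fin n) : Homog (d i - d j) fun t => (φ (.ofAdd t)).1 i j := by
  obtain ⟨P, hP⟩ := exists_polynomial_of_isMorphism hφ i j
  simp only [hP]
  refine homog_of_eval_sq_mul fun u t => ?_
  have h := congrFun (congrFun (congrArg Subtype.val (hconj u t)) i) j
  rw [Matrix.SpecialLinearGroup.coe_mul, Matrix.SpecialLinearGroup.coe_mul, hω,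
    Matrix.mul_diagonal, Matrix.diagonal_mul, hP, hP] at h
  rw [zpow_sub, Units.val_mul, mul_right_comm, ← h, mul_assoc, Units.mul_inv, mul_one]

theorem jmath_conj (u : Gm k) (t : k) :
    (⟨.ofAdd ((u : k) ^ 2 * t), 1⟩ * ⟨.ofAdd 0, u⟩ : GaGm k) =
      ⟨.ofAdd 0, u⟩ * ⟨.ofAdd t, 1⟩ := by
  rw [GaGm.mul_def, GaGm.mul_def]
  simp

/-- The factors are the restrictions of ψ∘j. Since d is antitone, entries on and below the diagonal
have weight at most 0; they are therefore constant in t and agree with the identity matrix, the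
value at t = 0. -/
theorem exists_psiOf_eq [Infinite k] {n : ℕ} {ψ : Borel k → SLn k n} (h : IsAntisymmetricHom ψ) :
    ∃ φ ∈ UnipotentUpper k n, ∃ ω ∈ Omega k n, ψ ∘ jmath = psiOf φ ω := by
  obtain ⟨⟨hmul, hmor⟩, hω⟩ := h
  have hmul' : ∀ x y : GaGm k, ψ (jmath (x * y)) = ψ (jmath x) * ψ (jmath y) := fun x y => by
    rw [jmath_mul, hmul]
  have hφmor : IsMorphism k fun t : Ga k => ψ (jmath ⟨t, 1⟩) := hmor.comp isMorphism_jmath_left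
  have hφmul : ∀ s t : Ga k, ψ (jmath ⟨s * t, 1⟩) = ψ (jmath ⟨s, 1⟩) * ψ (jmath ⟨t, 1⟩) := by
    intro s t
    rw [← hmul', GaGm.mul_def]
    simp
  have hφone : ψ (jmath ⟨.ofAdd 0, 1⟩) = 1 := by
    have := hφmul (.ofAdd 0) (.ofAdd 0)
    rwa [← ofAdd_add, add_zero, left_eq_mul] at this
  refine ⟨fun t => ψ (jmath ⟨t, 1⟩), ⟨⟨hφmul, hφmor⟩, ?_⟩, _, hω, funext fun x => ?_⟩
  · obtain ⟨d, hd, -, hdiag⟩ := hω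
    have hconst : ∀ i j, j ≤ i → ∀ t : Ga k,
        (ψ (jmath ⟨t, 1⟩)).1 i j = (1 : Matrix (Fin n) (Fin n) k) i j := by
      intro i j hij t
      have hh := homog_entry hφmor hdiag (fun u t => by rw [← hmul', ← hmul', jmath_conj]) i j
      refine (hh.eq_apply_zero (by linarith [hd hij]) t.toAdd).trans ?_
      rw [hφone]
      rfl
    refine fun t => ⟨fun i j hij => ?_, fun i => ?_⟩
    · rw [hconst i j hij.le, Matrix.one_apply_ne hij.ne']
    · rw [hconst i i le_rfl, Matrix.one_apply_eq]
  · simp only [Function.comp_apply, psiOf]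
    rw [← hmul', GaGm.mul_def]
    simp

theorem classified_of_mul [IsAlgClosed k] {p : ℕ} [Fact p.Prime] [CharP k p] {φ : Ga k → SLn k 4}
    {ω : Gm k → SLn k 4} (hφ : φ ∈ UnipotentUpper k 4) (hω : ω ∈ Omega k 4)
    (hmul : ∀ x y, psiOf φ ω (x * y) = psiOf φ ω x * psiOf φ ω y) : Classified p φ ω := by
  obtain ⟨d₁, d₂, h₂, h₁, rfl⟩ := exists_eq_omegaStar hω
  obtain ⟨⟨hφmul, hφmor⟩, hup⟩ := hφ
  have hφone : φ 1 = 1 := by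
    have := hφmul 1 1
    rwa [one_mul, left_eq_mul] at this
  have hωone : omegaStar (k := k) d₁ d₂ 1 = 1 := by
    have := (isAlgHom_omegaStar (k := k) d₁ d₂).map_mul 1 1
    rwa [one_mul, left_eq_mul] at this
  have hconj : ∀ (u : Gm k) (t : k),
      φ (.ofAdd ((u : k) ^ 2 * t)) * omegaStar d₁ d₂ u = omegaStar d₁ d₂ u * φ (.ofAdd t) := by
    intro u t
    have e₁ := hmul ⟨.ofAdd ((u : k) ^ 2 * t), 1⟩ ⟨.ofAdd 0, u⟩
    have e₂ := hmul ⟨.ofAdd 0, u⟩ ⟨.ofAdd t, 1⟩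
    rw [jmath_conj, e₂] at e₁
    simpa [psiOf, hφone, hωone] using e₁.symm
  have hent := fun i j => homog_entry hφmor (omegaStar_eq_diagonal d₁ d₂) hconj i j
  have huni : ∀ t, φ t = uni _ _ _ _ _ _ := fun t => eq_uni (hup t).1 (hup t).2
  obtain ⟨l, rfl⟩ := Int.eq_ofNat_of_zero_le (h₂.trans h₁)
  obtain ⟨n, rfl⟩ := Int.eq_ofNat_of_zero_le h₂
  have hln : n ≤ l := by exact_mod_cast h₁
  have h₁₂ : Homog ((l : ℤ) - n) fun t => (φ (.ofAdd t)).1 0 1 := hent 0 1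
  have h₁₃ : Homog ((l : ℤ) - -n) fun t => (φ (.ofAdd t)).1 0 2 := hent 0 2
  have h₂₄ : Homog ((n : ℤ) - -l) fun t => (φ (.ofAdd t)).1 1 3 := hent 1 3
  have h₃₄ : Homog (-(n : ℤ) - -l) fun t => (φ (.ofAdd t)).1 2 3 := hent 2 3
  obtain ⟨c₁₄, h₁₄⟩ := (hent 0 3).exists_eq_mul_pow (m := l)
    (show (l : ℤ) - -l = 2 * l by ring)
  obtain ⟨c₂₃, h₂₃⟩ := (hent 1 2).exists_eq_mul_pow (m := n)
    (show (n : ℤ) - -n = 2 * n by ring)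
  have hadd : ∀ {a b c d e f : k → k}, (∀ t : Ga k, φ t =
      uni (a t.toAdd) (b t.toAdd) (c t.toAdd) (d t.toAdd) (e t.toAdd) (f t.toAdd)) →
      UniAdditive a b c d e f := by
    intro a b c d e f h s t
    have := hφmul (.ofAdd s) (.ofAdd t)
    rwa [← ofAdd_add, h, h, h, uni_mul, uni_inj] at this
  rcases Nat.even_or_odd (l - n) with ⟨m, hm⟩ | ⟨m, hm⟩
  · obtain rfl : l = 2 * m + n := by omega
    obtain ⟨c₁₂, h₁₂⟩ := h₁₂.exists_eq_mul_pow (m := m) (by push_cast; ring)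
    obtain ⟨c₁₃, h₁₃⟩ := h₁₃.exists_eq_mul_pow (m := m + n) (by push_cast; ring)
    obtain ⟨c₂₄, h₂₄⟩ := h₂₄.exists_eq_mul_pow (m := m + n) (by push_cast; ring)
    obtain ⟨c₃₄, h₃₄⟩ := h₃₄.exists_eq_mul_pow (m := m) (by push_cast; ring)
    have hφeq : φ = mono m (m + n) (2 * m + n) n c₁₂ c₁₃ c₁₄ c₂₃ c₂₄ c₃₄ := by
      funext t
      rw [huni, mono, uni_inj]
      exact ⟨h₁₂ _, h₁₃ _, h₁₄ _, h₂₃ _, h₂₄ _, h₃₄ _⟩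
    rw [hφeq]
    exact classified_of_uniAdditive (hadd (congrFun hφeq))
  · have ho : Odd ((l : ℤ) - n) := ⟨m, by omega⟩
    have ho' : Odd ((l : ℤ) - -n) := ⟨m + n, by omega⟩
    have ho'' : Odd ((n : ℤ) - -l) := ⟨m + n, by omega⟩
    have ho''' : Odd (-(n : ℤ) - -l) := ⟨m, by omega⟩
    -- An odd weight admits no monomial; the exponents 0 only accompany zero coefficients.
    have hφeq : φ = mono 0 0 l n 0 0 c₁₄ c₂₃ 0 0 := by
      funext t
      rw [huni, mono, uni_inj]
      simp only [zero_mul]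
      exact ⟨h₁₂.eq_zero_of_odd ho _, h₁₃.eq_zero_of_odd ho' _, h₁₄ _, h₂₃ _,
        h₂₄.eq_zero_of_odd ho'' _, h₃₄.eq_zero_of_odd ho''' _⟩
    have ha : UniAdditive (fun t : k => 0 * t ^ 0) (fun t => 0 * t ^ 0) (fun t => c₁₄ * t ^ l)
        (fun t => c₂₃ * t ^ n) (fun t => 0 * t ^ 0) (fun t => 0 * t ^ 0) := hadd (congrFun hφeq)
    rw [hφeq]
    refine classified_of_c₁₄_c₂₃ hln (fun s t => ?_)
      fun s t => (ha s t).2.2.2.1.trans (add_comm _ _)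
    have := (ha s t).2.2.1
    linear_combination this

end Representations

end BorelRep

/-! ### The main theorem -/

open BorelRep
theorem theorem3p1 {k : Type*} [Field k] [IsAlgClosed k] (p : ℕ) [Fact p.Prime] [CharP k p] :
    (∀ (ν : Label) (φ' : Ga k → SLn k 4) (ω' : Gm k → SLn k 4), HasForm p φ' ω' ν →
      IsAlgHom k φ' ∧ IsAlgHom k ω' ∧ IsAlgHom k (psiOf φ' ω') ∧ ω' ∈ Omega k 4) ∧
    (∀ ψ : Borel k → SLn k 4, IsAntisymmetricHom ψ →
      (∃ φ ∈ UnipotentUpper k 4, ∃ ω ∈ Omega k 4, ψ ∘ jmath = psiOf φ ω) ∧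
      ∀ φ ∈ UnipotentUpper k 4, ∀ ω ∈ Omega k 4, ψ ∘ jmath = psiOf φ ω →
        ∃ φ' ∈ UnipotentUpper k 4, ∃ ω' ∈ Omega k 4,
          PairEquiv φ ω φ' ω' ∧ ∃ ν : Label, HasForm p φ' ω' ν) := by
  refine ⟨fun ν φ' ω' h => ?_, fun ψ hψ => ⟨exists_psiOf_eq hψ, fun φ hφ ω hω hψφ => ?_⟩⟩
  · obtain ⟨h₁, h₂, h₃, h₄⟩ := h.isRepPair
    exact ⟨h₁.1, h₃, h₄, h₂⟩
  · obtain ⟨φ', ω', heq, ν, hν⟩ := classified_of_mul (p := p) hφ hω fun x y => by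
      rw [← hψφ, Function.comp_apply, jmath_mul, hψ.1.map_mul]
      rfl
    -- The classification does not carry membership in 𝒰₄ and Ω(4); it follows from the form itself,
    -- as in the first part.
    exact ⟨φ', hν.isRepPair.1, ω', hν.isRepPair.2.1, heq, ν, hν⟩
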